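/- For $R\in SO(3)$ let $U_R=\mathbb S^2\setminus\{R\mathbf N,R\mathbf S\}$, where $\mathbf N,\mathbf S=(0,0,\pm1)$, with the spherical coordinates $(\vartheta_R,\varphi_R)$ obtained by rotating the standard ones by $R$, and let $\rho_R(p)$ be the unit tangent vector at $p\in U_R$ along the circle $\vartheta_R=\text{const}$ in the direction of increasing $\varphi_R$. For $p\in U_{R_1}\cap U_{R_2}$ let $\psi_{pR_2R_1}$ be the angle from $\rho_{R_1}(p)$ to $\rho_{R_2}(p)$, the tangent plane being oriented by the inward normal $-p$. For $s\in\mathbb Z$, a smooth spin $s$ function on $\mathbb S^2$ is a family $F=(F_R)_{R\in SO(3)}$ with $F_R\in C^\infty(U_R)$ and $F_{R_2}(p)=e^{is\psi_{pR_2R_1}}F_{R_1}(p)$ for all $R_1,R_2\in SO(3)$ and $p\in U_{R_1}\cap U_{R_2}$. Products are taken chart by chart, $(FG)_R=F_RG_R$. On spin $s$ functions define $$(\eth F)_R=-(\sin\vartheta_R)^s\Big[\tfrac{\partial}{\partial\vartheta_R}+\tfrac{i}{\sin\vartheta_R}\tfrac{\partial}{\partial\varphi_R}\Big](\sin\vartheta_R)^{-s}F_R,\qquad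 (\overline\eth F)_R=-(\sin\vartheta_R)^{-s}\Big[\tfrac{\partial}{\partial\vartheta_R}-\tfrac{i}{\sin\vartheta_R}\tfrac{\partial}{\partial\varphi_R}\Big](\sin\vartheta_R)^{s}F_R .$$ Let $Y_{lm}$ ($l\ge0$, $-l\le m\le l$) be the standard spherical harmonics. For $l\ge|s|$ let $$Y_{lm,s}=\Big\{\tfrac{(l-|s|)!}{(l+|s|)!}\Big\}^{1/2}\eth^{s}Y_{lm}\ \ (s\ge0),\qquad Y_{lm,s}=\Big\{\tfrac{(l-|s|)!}{(l+|s|)!}\Big\}^{1/2}(-\overline\eth)^{|s|}Y_{lm}\ \ (s<0),$$ let $\mathcal H_{ls}$ be the linear span of the $Y_{lm,s}$, $-l\le m\le l$, and for an integer $L\ge|s|$ let $V_{L,s}=\bigoplus_{l=|s|}^{L}\mathcal H_{ls}$ (the spin $s$ functions of band limit $L$). **Lemma.** Let $r,s\in\mathbb Z$ and let $K\ge|r|$ and $L\ge|s|$ be integers. If $F\in V_{K,r}$ and $G\in V_{L,s}$, then $FG$ is a smooth spin $r+s$ function and $FG\in V_{K+L+|r+s|,\,r+s}$; that is, $$V_{K,r}V_{L,s}\subseteq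 V_{K+L+|r+s|,\,r+s}.$$ -/

import Mathlib

open scoped Manifold ContDiff Matrix

noncomputable section

namespace SpinSphere

/-- The unit sphere `𝕊²` in `ℝ³`, with Mathlib's manifold structure. -/
abbrev S2 : Type := Metric.sphere (0 : EuclideanSpace ℝ (Fin 3)) 1

/-- The rotation group `SO(3)`. -/
abbrev SO3 : Type := Matrix.specialOrthogonalGroup (Fin 3) ℝ

/-- Coordinates of a point of the sphere, as a plain vector. -/
def vec (p : S2) : Fin 3 → ℝ := p.1.ofLp

theorem vec_dotProduct_self (p : S2) : vec p ⬝ᵥ vec p = 1 := by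
  have h : ‖p.1‖ = 1 := by simp
  have h2 := EuclideanSpace.real_norm_sq_eq p.1
  rw [h] at h2
  simp only [vec, dotProduct, ← sq]
  linarith

/-- The point of the sphere with given coordinates of unit length. -/
def mkPoint (v : Fin 3 → ℝ) (hv : v ⬝ᵥ v = 1) : S2 :=
  ⟨WithLp.toLp 2 v, by
    have h2 := EuclideanSpace.real_norm_sq_eq (WithLp.toLp 2 v)
    have h3 : ‖WithLp.toLp 2 v‖ ^ 2 = 1 := by
      rw [h2, ← hv]
      simp [dotProduct, sq]
    have h4 : ‖WithLp.toLp 2 v‖ = 1 := by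
      have h5 := norm_nonneg (WithLp.toLp 2 v)
      nlinarith
    simpa using h4⟩

theorem rotation_dotProduct (R : SO3) (v w : Fin 3 → ℝ) :
    (R.1 *ᵥ v) ⬝ᵥ (R.1 *ᵥ w) = v ⬝ᵥ w := by
  have h : R.1ᵀ * R.1 = 1 := by
    have h1 := (Matrix.mem_specialOrthogonalGroup_iff.1 R.2).1
    have h2 := (Matrix.mem_orthogonalGroup_iff' (Fin 3) ℝ).1 h1
    simpa [Matrix.star_eq_conjTranspose] using h2
  rw [Matrix.dotProduct_mulVec, Matrix.vecMul_mulVec, h, Matrix.vecMul_one]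

/-- The action of a rotation on a point of the sphere. -/
def rot (R : SO3) (p : S2) : S2 :=
  mkPoint (R.1 *ᵥ vec p) (by rw [rotation_dotProduct, vec_dotProduct_self])

/-- The north pole `(0, 0, 1)`. -/
def northPole : S2 := mkPoint ![0, 0, 1] (by simp [dotProduct, Fin.sum_univ_three])

/-- The south pole `(0, 0, -1)`. -/
def southPole : S2 := mkPoint ![0, 0, -1] (by simp [dotProduct, Fin.sum_univ_three])

/-- The chart domain `U_R = R (𝕊² \ {N, S}) = 𝕊² \ {R N, R S}`. -/
def chart (R : SO3) : TopologicalSpace.Opens S2 :=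
  ⟨{rot R northPole, rot R southPole}ᶜ, (Set.toFinite _).isClosed.isOpen_compl⟩

/-- The point with standard spherical coordinates `(θ, φ)`. -/
def sphericalPoint (θ φ : ℝ) : S2 :=
  mkPoint ![Real.sin θ * Real.cos φ, Real.sin θ * Real.sin φ, Real.cos θ] (by
    simp only [dotProduct, Fin.sum_univ_three, Matrix.cons_val]
    have h1 := Real.sin_sq_add_cos_sq θ
    have h2 := Real.sin_sq_add_cos_sq φ
    linear_combination h1 + (Real.sin θ) ^ 2 * h2)

/-- The point whose coordinates in the system rotated by `R` are `(θ_R, φ_R) = (θ, φ)`. -/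
def coordPoint (R : SO3) (θ φ : ℝ) : S2 := rot R (sphericalPoint θ φ)

/-- The colatitude `θ_R` of a point, the spherical coordinate `θ` of `R⁻¹ p`. -/
def colatitude (R : SO3) (p : S2) : ℝ := Real.arccos (vec (rot R⁻¹ p) 2)

/-- The longitude `φ_R` of a point, the spherical coordinate `φ` of `R⁻¹ p`. -/
def longitude (R : SO3) (p : S2) : ℝ :=
  Complex.arg ⟨vec (rot R⁻¹ p) 0, vec (rot R⁻¹ p) 1⟩

/-- The reference direction `ρ_R(p)`: the unit tangent vector at `p ∈ U_R` along the circle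
`θ_R = const`, in the direction of increasing `φ_R`. -/
def refDir (R : SO3) (p : S2) : Fin 3 → ℝ :=
  R.1 *ᵥ ![-Real.sin (longitude R p), Real.cos (longitude R p), 0]

/-- The oriented angle `ψ_{p R₂ R₁}` from `ρ_{R₁}(p)` to `ρ_{R₂}(p)`. The orientation is the one
in which the angle at the south pole from `i` to `j`, and at the north pole from `j` to `i`,
is `π / 2`; that is, the tangent plane is oriented by the inward normal `-p`. -/
def orientedAngle (p : S2) (R₂ R₁ : SO3) : ℝ :=
  Complex.arg ⟨refDir R₁ p ⬝ᵥ refDir R₂ p, -vec p ⬝ᵥ (refDir R₁ p ⨯₃ refDir R₂ p)⟩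

/-- Families `(F_R)` of complex functions, `F_R` on `U_R`, indexed by `R ∈ SO(3)`. Sums,
scalar multiples and products are taken chart by chart: `(F * G)_R = F_R G_R`. -/
abbrev Family : Type := (R : SO3) → chart R → ℂ

/-- `F ∈ C_s^∞(𝕊²)`: a smooth spin `s` function on the sphere. -/
structure IsSmoothSpin (s : ℤ) (F : Family) : Prop where
  smooth : ∀ R : SO3, ContMDiff (𝓡 2) 𝓘(ℝ, ℂ) ∞ (F R)
  transition : ∀ (R₁ R₂ : SO3) (p : S2) (h₁ : p ∈ chart R₁) (h₂ : p ∈ chart R₂),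
    F R₂ ⟨p, h₂⟩ = Complex.exp (Complex.I * s * orientedAngle p R₂ R₁) * F R₁ ⟨p, h₁⟩

/-- A function on `U_R` as a function of the coordinates `(θ_R, φ_R)`, `0 < θ_R < π`
(with value `0` where the coordinates do not give a point of `U_R`). -/
def inCoords (R : SO3) (f : chart R → ℂ) (θ φ : ℝ) : ℂ :=
  Function.extend Subtype.val f 0 (coordPoint R θ φ)

/-- The spin-raising operator `ð` on spin `s` functions:
`(ð F)_R = - sin^s θ_R (∂/∂θ_R + (i / sin θ_R) ∂/∂φ_R) (sin^(-s) θ_R F_R)`. -/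
def eth (s : ℤ) (F : Family) : Family := fun R p =>
  let θ := colatitude R p.1
  let φ := longitude R p.1;
  (-(Real.sin θ : ℂ) ^ s) *
    (deriv (fun t : ℝ => (Real.sin t : ℂ) ^ (-s) * inCoords R (F R) t φ) θ +
      Complex.I / (Real.sin θ : ℂ) *
        deriv (fun u : ℝ => (Real.sin θ : ℂ) ^ (-s) * inCoords R (F R) θ u) φ)

/-- The spin-lowering operator `ð̄` on spin `s` functions:
`(ð̄ F)_R = - sin^(-s) θ_R (∂/∂θ_R - (i / sin θ_R) ∂/∂φ_R) (sin^s θ_R F_R)`. -/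
def ethBar (s : ℤ) (F : Family) : Family := fun R p =>
  let θ := colatitude R p.1
  let φ := longitude R p.1;
  (-(Real.sin θ : ℂ) ^ (-s)) *
    (deriv (fun t : ℝ => (Real.sin t : ℂ) ^ s * inCoords R (F R) t φ) θ -
      Complex.I / (Real.sin θ : ℂ) *
        deriv (fun u : ℝ => (Real.sin θ : ℂ) ^ s * inCoords R (F R) θ u) φ)

/-- `ð^n` applied to a spin `0` function. -/
def ethPow : ℕ → Family → Family
  | 0, F => F
  | n + 1, F => eth n (ethPow n F)

/-- `(-ð̄)^n` applied to a spin `0` function. -/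
def negEthBarPow : ℕ → Family → Family
  | 0, F => F
  | n + 1, F => -ethBar (-(n : ℤ)) (negEthBarPow n F)

/-- The Legendre polynomial `P_l`, by Rodrigues' formula. -/
def legendre (l : ℕ) : Polynomial ℝ :=
  Polynomial.C (1 / (2 ^ l * (l.factorial : ℝ))) *
    Polynomial.derivative^[l] ((Polynomial.X ^ 2 - 1) ^ l)

/-- The standard spherical harmonic `Y_{lm}` for `0 ≤ m ≤ l`,
`(-1)^m √((2l+1)/(4π) (l-m)!/(l+m)!) sin^m θ P_l^{(m)}(cos θ) e^{imφ}`,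
where `sin^m θ e^{imφ} = (x + iy)^m` and `cos θ = z`. -/
def sphHarmonicNonneg (l m : ℕ) (p : S2) : ℂ :=
  (-1) ^ m *
    (Real.sqrt ((2 * l + 1) / (4 * Real.pi) *
      (((l - m).factorial : ℝ) / ((l + m).factorial : ℝ))) : ℂ) *
    (⟨vec p 0, vec p 1⟩ : ℂ) ^ m *
    (((Polynomial.derivative^[m] (legendre l)).eval (vec p 2) : ℝ) : ℂ)

/-- The standard spherical harmonic `Y_{lm}` for `-l ≤ m ≤ l`, with
`Y_{l,-m} = (-1)^m conj Y_{lm}`. -/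
def sphHarmonic (l : ℕ) (m : ℤ) (p : S2) : ℂ :=
  if 0 ≤ m then sphHarmonicNonneg l m.natAbs p
  else (-1) ^ m.natAbs * (starRingEnd ℂ) (sphHarmonicNonneg l m.natAbs p)

/-- A function on the sphere as a spin `0` function. -/
def ofFun (f : S2 → ℂ) : Family := fun _ p => f p.1

/-- The spin `s` spherical harmonic `Y_{lm,s}`, for `l ≥ |s|`, `-l ≤ m ≤ l`. -/
def spinHarmonic (l : ℕ) (m s : ℤ) : Family :=
  (Real.sqrt (((l - s.natAbs).factorial : ℝ) / ((l + s.natAbs).factorial : ℝ)) : ℂ) •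
    (if 0 ≤ s then ethPow s.natAbs (ofFun (sphHarmonic l m))
      else negEthBarPow s.natAbs (ofFun (sphHarmonic l m)))

/-- `H_{ls}`, the linear span of the `Y_{lm,s}`, `-l ≤ m ≤ l`. -/
def harmonicSpace (l : ℕ) (s : ℤ) : Submodule ℂ Family :=
  Submodule.span ℂ {F | ∃ m : ℤ, -(l : ℤ) ≤ m ∧ m ≤ l ∧ F = spinHarmonic l m s}

/-- `V_{L,s}`, the sum of the `H_{ls}` for `|s| ≤ l ≤ L`: the spin `s` functions
of band limit `L`. -/
def bandLimited (L : ℕ) (s : ℤ) : Submodule ℂ Family :=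
  ⨆ l ∈ Finset.Icc s.natAbs L, harmonicSpace l s

end SpinSphere

end

noncomputable section

namespace SpinSphere

/-! ### Vector algebra of orthonormal frames -/

/-! Band-limited spin functions are polynomials, and polynomials multiply with addition of degrees.
Two vectors generate everything: the position `p` (components of spin 0) and the null vector `m =
e_θ + i e_φ` (components of spin 1). They satisfy `ð p = -m` and `ð m = 0`, and `ð` obeys the
Leibniz rule. Let P be the span of 1 and the components of `p`, let N be the span of the components
of `m`, and N* its conjugate. The central fact is V_{L,n} = P^(L-n) N^n for 0 ≤ n ≤ L, with N* in
place of N for spin -n.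

The inclusion from left to right holds because Y_lm is a polynomial of degree l and each `ð` trades
one factor of P for one of N (`ethPow_mem`). The converse needs two facts. First, polynomials of
degree at most L are spanned by the Y_lm with l ≤ L (`posSpace_pow_le_harmonicSpan`). Second, `ð`
maps P^(d+1) N^n onto P^d N^(n+1) (`nullSpace_pow_succ_le_raiseImage`); this rests on `p × m = -i
m`, by which `p_i m_j - p_j m_i` has lower degree, and on an Euler-type relation derived from it.
Negative spins follow by complex conjugation, which exchanges `ð` and its bar.

For spins of equal sign the product formula is then immediate. For opposite signs, N N* ⊆ P^2
(`nullSpace_mul_nullStarSpace_le`) cancels null factors in pairs. In every case the degrees add up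
to the band limit K + L, so the summand |r+s| is slack. Smoothness and the transition rule are
checked on the generators only. -/

theorem cross_frame_swap (u p : Fin 3 → ℝ) (hp : p ⬝ᵥ p = 1) (hup : u ⬝ᵥ p = 0) :
    p ⨯₃ (u ⨯₃ p) = u := by
  simp only [dotProduct, Fin.sum_univ_three] at hp hup
  ext i
  fin_cases i <;> simp [cross_apply]
  · linear_combination u 0 * hp - p 0 * hup
  · linear_combination u 1 * hp - p 1 * hup
  · linear_combination u 2 * hp - p 2 * hup

/-- Completeness of the orthonormal frame `(u × p, u, p)`. -/
theorem frame_complete (u p : Fin 3 → ℝ) (hu : u ⬝ᵥ u = 1) (hp : p ⬝ᵥ p = 1)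
    (hup : u ⬝ᵥ p = 0) (i j : Fin 3) :
    (u ⨯₃ p) i * (u ⨯₃ p) j + u i * u j + p i * p j = if i = j then 1 else 0 := by
  have hN : (!![(u ⨯₃ p) 0, (u ⨯₃ p) 1, (u ⨯₃ p) 2; u 0, u 1, u 2; p 0, p 1, p 2]) *
      (!![(u ⨯₃ p) 0, (u ⨯₃ p) 1, (u ⨯₃ p) 2; u 0, u 1, u 2; p 0, p 1, p 2])ᵀ = 1 := by
    simp only [dotProduct, Fin.sum_univ_three] at hu hp hup
    ext a b
    fin_cases a <;> fin_cases b <;>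
      simp [cross_apply, Matrix.mul_apply, Fin.sum_univ_three]
    · linear_combination hu + (u 0 * u 0 + u 1 * u 1 + u 2 * u 2) * hp -
        (u 0 * p 0 + u 1 * p 1 + u 2 * p 2) * hup
    · ring
    · ring
    · ring
    · linear_combination hu
    · linear_combination hup
    · ring
    · linear_combination hup
    · linear_combination hp
  -- Orthonormal rows of a square matrix force orthonormal columns.
  have hN' := mul_eq_one_comm.1 hN
  have := congrFun (congrFun hN' i) j
  rw [Matrix.mul_apply, Matrix.one_apply] at this
  rw [← this]
  fin_cases i <;> fin_cases j <;> simp [Fin.sum_univ_three]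

/-- A unit vector `v` orthogonal to `p` in terms of the frame `(u × p, u, p)`. -/
theorem tangent_expand (u v p : Fin 3 → ℝ) (hu : u ⬝ᵥ u = 1) (hp : p ⬝ᵥ p = 1)
    (hup : u ⬝ᵥ p = 0) (hvp : v ⬝ᵥ p = 0) (i : Fin 3) :
    v i = (u ⬝ᵥ v) * u i + (-p ⬝ᵥ (u ⨯₃ v)) * (u ⨯₃ p) i := by
  have h := fun j => frame_complete u p hu hp hup i j
  have h0 := h 0
  have h1 := h 1
  have h2 := h 2
  simp only [dotProduct, Fin.sum_univ_three, Pi.neg_apply] at *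
  have hv : v i = (if i = 0 then (1 : ℝ) else 0) * v 0 + (if i = 1 then (1 : ℝ) else 0) * v 1 +
      (if i = 2 then (1 : ℝ) else 0) * v 2 := by
    fin_cases i <;> simp
  rw [hv, ← h0, ← h1, ← h2]
  simp only [cross_apply, Matrix.cons_val]
  linear_combination p i * hvp

/-- The quarter turn `· × p` applied to `tangent_expand`, since `(u × p) × p = -u`. Together the two
expansions say that `v × p + i v` is `u × p + i u` times a complex number. -/
theorem tangent_cross_expand (u v p : Fin 3 → ℝ) (hu : u ⬝ᵥ u = 1) (hp : p ⬝ᵥ p = 1)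
    (hup : u ⬝ᵥ p = 0) (hvp : v ⬝ᵥ p = 0) (i : Fin 3) :
    (v ⨯₃ p) i = (u ⬝ᵥ v) * (u ⨯₃ p) i - (-p ⬝ᵥ (u ⨯₃ v)) * u i := by
  have hv : v = (u ⬝ᵥ v) • u + (-p ⬝ᵥ (u ⨯₃ v)) • (u ⨯₃ p) := by
    ext j
    simpa using tangent_expand u v p hu hp hup hvp j
  have h2 : (u ⨯₃ p) ⨯₃ p = -u := by
    rw [← cross_anticomm, cross_frame_swap u p hp hup]
  conv_lhs => rw [hv]
  simp [LinearMap.map_add, h2]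

theorem tangent_normSq (u v p : Fin 3 → ℝ) (hu : u ⬝ᵥ u = 1) (hp : p ⬝ᵥ p = 1)
    (hv : v ⬝ᵥ v = 1) (hup : u ⬝ᵥ p = 0) (hvp : v ⬝ᵥ p = 0) :
    (u ⬝ᵥ v) ^ 2 + (-p ⬝ᵥ (u ⨯₃ v)) ^ 2 = 1 := by
  have h := fun j => tangent_expand u v p hu hp hup hvp j
  have h1 : v ⬝ᵥ v = (u ⬝ᵥ v) * (u ⬝ᵥ v) + (-p ⬝ᵥ (u ⨯₃ v)) * ((u ⨯₃ p) ⬝ᵥ v) := by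
    conv_lhs => rw [dotProduct, Fin.sum_univ_three]
    conv_lhs => enter [1, 1, 1]; rw [h 0]
    conv_lhs => enter [1, 2, 1]; rw [h 1]
    conv_lhs => enter [2, 1]; rw [h 2]
    simp only [dotProduct, Fin.sum_univ_three]
    ring
  have h2 : (u ⨯₃ p) ⬝ᵥ v = -p ⬝ᵥ (u ⨯₃ v) := by
    simp only [dotProduct, Fin.sum_univ_three, cross_apply, Pi.neg_apply, Matrix.cons_val]
    ring
  rw [hv, h2] at h1
  linarith

/-! ### Rotations -/

theorem transpose_mul_self (R : SO3) : R.1ᵀ * R.1 = 1 := by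
  have h1 := (Matrix.mem_specialOrthogonalGroup_iff.1 R.2).1
  have h2 := (Matrix.mem_orthogonalGroup_iff' (Fin 3) ℝ).1 h1
  simpa [Matrix.star_eq_conjTranspose] using h2

theorem det_eq_one (R : SO3) : R.1.det = 1 := (Matrix.mem_specialOrthogonalGroup_iff.1 R.2).2

theorem mul_inv_val (R : SO3) : R.1 * (R⁻¹).1 = 1 := by
  exact congrArg Subtype.val (mul_inv_cancel R)

theorem inv_mul_val (R : SO3) : (R⁻¹).1 * R.1 = 1 := by
  exact congrArg Subtype.val (inv_mul_cancel R)

/-- For a rotation the transpose is the adjugate, so each entry of `R` equals its cofactor; these 2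
× 2 minors are the ones produced by the cross product. -/
theorem mulVec_cross (R : SO3) (v w : Fin 3 → ℝ) :
    (R.1 *ᵥ v) ⨯₃ (R.1 *ᵥ w) = R.1 *ᵥ (v ⨯₃ w) := by
  have hadj : R.1ᵀ = R.1.adjugate := by
    have h := Matrix.mul_adjugate R.1
    rw [det_eq_one, one_smul] at h
    calc R.1ᵀ = R.1ᵀ * (R.1 * R.1.adjugate) := by rw [h, mul_one]
      _ = R.1.adjugate := by rw [← mul_assoc, transpose_mul_self, one_mul]
  rw [Matrix.adjugate_fin_three] at hadj
  have h := fun i j => congrFun (congrFun hadj i) j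
  have h00 := h 0 0
  have h01 := h 0 1
  have h02 := h 0 2
  have h10 := h 1 0
  have h11 := h 1 1
  have h12 := h 1 2
  have h20 := h 2 0
  have h21 := h 2 1
  have h22 := h 2 2
  simp [Matrix.transpose_apply] at h00 h01 h02 h10 h11 h12 h20 h21 h22
  ext i
  fin_cases i <;> simp [cross_apply, Matrix.mulVec, dotProduct, Fin.sum_univ_three]
  · rw [h00, h10, h20]; ring
  · rw [h01, h11, h21]; ring
  · rw [h02, h12, h22]; ring

theorem vec_injective : Function.Injective vec := fun p q h => by
  apply Subtype.ext
  exact WithLp.ofLp_injective 2 h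

theorem vec_rot (R : SO3) (p : S2) : vec (rot R p) = R.1 *ᵥ vec p := rfl

theorem rot_rot_inv (R : SO3) (p : S2) : rot R (rot R⁻¹ p) = p := by
  apply vec_injective
  rw [vec_rot, vec_rot, Matrix.mulVec_mulVec, mul_inv_val, Matrix.one_mulVec]

theorem rot_inv_rot (R : SO3) (p : S2) : rot R⁻¹ (rot R p) = p := by
  apply vec_injective
  rw [vec_rot, vec_rot, Matrix.mulVec_mulVec, inv_mul_val, Matrix.one_mulVec]

/-! ### Spherical coordinates -/

theorem vec_sq_sum (p : S2) : vec p 0 ^ 2 + vec p 1 ^ 2 + vec p 2 ^ 2 = 1 := by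
  have h := vec_dotProduct_self p
  simp only [dotProduct, Fin.sum_univ_three] at h
  linarith

theorem mem_chart_iff (R : SO3) (p : S2) :
    p ∈ chart R ↔ 0 < vec (rot R⁻¹ p) 0 ^ 2 + vec (rot R⁻¹ p) 1 ^ 2 := by
  have hmem : p ∈ chart R ↔ ¬ (p = rot R northPole ∨ p = rot R southPole) := Iff.rfl
  rw [hmem]
  have hn : vec northPole = ![0, 0, 1] := rfl
  have hs : vec southPole = ![0, 0, -1] := rfl
  constructor
  · intro h
    by_contra hcon
    apply h
    have h0 : vec (rot R⁻¹ p) 0 = 0 := by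
      nlinarith [sq_nonneg (vec (rot R⁻¹ p) 0), sq_nonneg (vec (rot R⁻¹ p) 1)]
    have h1 : vec (rot R⁻¹ p) 1 = 0 := by
      nlinarith [sq_nonneg (vec (rot R⁻¹ p) 0), sq_nonneg (vec (rot R⁻¹ p) 1)]
    have h2 := vec_sq_sum (rot R⁻¹ p)
    rw [h0, h1] at h2
    have h3 : vec (rot R⁻¹ p) 2 = 1 ∨ vec (rot R⁻¹ p) 2 = -1 := by
      exact sq_eq_one_iff.1 (by linarith)
    rcases h3 with h3 | h3
    · left
      rw [← rot_rot_inv R p]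
      congr 1
      apply vec_injective
      rw [hn]
      ext i
      fin_cases i <;> simp [h0, h1, h3]
    · right
      rw [← rot_rot_inv R p]
      congr 1
      apply vec_injective
      rw [hs]
      ext i
      fin_cases i <;> simp [h0, h1, h3]
  · rintro h (rfl | rfl)
    · rw [rot_inv_rot, hn] at h
      simp at h
    · rw [rot_inv_rot, hs] at h
      simp at h

theorem vec_sphericalPoint (θ φ : ℝ) : vec (sphericalPoint θ φ) =
    ![Real.sin θ * Real.cos φ, Real.sin θ * Real.sin φ, Real.cos θ] := rfl

theorem coordPoint_mem_chart (R : SO3) {θ : ℝ} (hθ : Real.sin θ ≠ 0) (φ : ℝ) :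
    coordPoint R θ φ ∈ chart R := by
  rw [mem_chart_iff, coordPoint, rot_inv_rot, vec_sphericalPoint]
  simp only [Matrix.cons_val]
  have : (Real.sin θ * Real.cos φ) ^ 2 + (Real.sin θ * Real.sin φ) ^ 2 = Real.sin θ ^ 2 := by
    linear_combination Real.sin θ ^ 2 * Real.sin_sq_add_cos_sq φ
  rw [this]
  positivity

theorem longitude_complex_ne_zero (R : SO3) {p : S2} (hp : p ∈ chart R) :
    (⟨vec (rot R⁻¹ p) 0, vec (rot R⁻¹ p) 1⟩ : ℂ) ≠ 0 := by
  intro h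
  rw [mem_chart_iff] at hp
  have h0 := congrArg Complex.re h
  have h1 := congrArg Complex.im h
  simp only [Complex.zero_re, Complex.zero_im] at h0 h1
  rw [h0, h1] at hp
  simp at hp

/-- The distance from the axis of the rotated coordinates. -/
def axisDist (R : SO3) (p : S2) : ℝ := √(vec (rot R⁻¹ p) 0 ^ 2 + vec (rot R⁻¹ p) 1 ^ 2)

theorem axisDist_pos (R : SO3) {p : S2} (hp : p ∈ chart R) : 0 < axisDist R p :=
  Real.sqrt_pos.2 ((mem_chart_iff R p).1 hp)

theorem cos_longitude (R : SO3) {p : S2} (hp : p ∈ chart R) :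
    Real.cos (longitude R p) = vec (rot R⁻¹ p) 0 / axisDist R p := by
  rw [longitude, Complex.cos_arg (longitude_complex_ne_zero R hp), Complex.norm_eq_sqrt_sq_add_sq,
    axisDist]

theorem sin_longitude (R : SO3) (p : S2) :
    Real.sin (longitude R p) = vec (rot R⁻¹ p) 1 / axisDist R p := by
  rw [longitude, Complex.sin_arg, Complex.norm_eq_sqrt_sq_add_sq, axisDist]

theorem sin_colatitude (R : SO3) (p : S2) : Real.sin (colatitude R p) = axisDist R p := by
  rw [colatitude, Real.sin_arccos, axisDist]
  congr 1
  linarith [vec_sq_sum (rot R⁻¹ p)]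

theorem cos_colatitude (R : SO3) (p : S2) :
    Real.cos (colatitude R p) = vec (rot R⁻¹ p) 2 := by
  have := vec_sq_sum (rot R⁻¹ p)
  rw [colatitude, Real.cos_arccos] <;>
    nlinarith [sq_nonneg (vec (rot R⁻¹ p) 0), sq_nonneg (vec (rot R⁻¹ p) 1)]

theorem sphericalPoint_colatitude_longitude (R : SO3) {p : S2} (hp : p ∈ chart R) :
    sphericalPoint (colatitude R p) (longitude R p) = rot R⁻¹ p := by
  apply vec_injective
  have h := (axisDist_pos R hp).ne'
  rw [vec_sphericalPoint, sin_colatitude, cos_colatitude, cos_longitude R hp, sin_longitude]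
  ext i
  fin_cases i <;> simp <;> field_simp

theorem coordPoint_colatitude_longitude (R : SO3) {p : S2} (hp : p ∈ chart R) :
    coordPoint R (colatitude R p) (longitude R p) = p := by
  rw [coordPoint, sphericalPoint_colatitude_longitude R hp, rot_rot_inv]

/-- Only the cosine and sine of the longitude enter, so the branch of the argument is irrelevant. A
negative `sin θ` would reverse the direction. -/
theorem refDir_coordPoint (R : SO3) {θ : ℝ} (hθ : 0 < Real.sin θ) (φ : ℝ) :
    refDir R (coordPoint R θ φ) = R.1 *ᵥ ![-Real.sin φ, Real.cos φ, 0] := by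
  have hmem := coordPoint_mem_chart R hθ.ne' φ
  have hd : axisDist R (coordPoint R θ φ) = Real.sin θ := by
    rw [axisDist, coordPoint, rot_inv_rot, vec_sphericalPoint]
    simp only [Matrix.cons_val]
    rw [Real.sqrt_eq_iff_mul_self_eq_of_pos hθ]
    linear_combination -(Real.sin θ) ^ 2 * Real.sin_sq_add_cos_sq φ
  rw [refDir, cos_longitude R hmem, sin_longitude, hd, coordPoint, rot_inv_rot,
    vec_sphericalPoint]
  have h := hθ.ne'
  congr 1
  ext i
  fin_cases i <;> simp <;> field_simp

theorem refDir_dotProduct_self (R : SO3) (p : S2) : refDir R p ⬝ᵥ refDir R p = 1 := by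
  rw [refDir, rotation_dotProduct]
  simp [dotProduct, Fin.sum_univ_three]
  linear_combination Real.sin_sq_add_cos_sq (longitude R p)

theorem refDir_dotProduct_vec (R : SO3) {p : S2} (hp : p ∈ chart R) :
    refDir R p ⬝ᵥ vec p = 0 := by
  conv_lhs => enter [2]; rw [← coordPoint_colatitude_longitude R hp, coordPoint, vec_rot]
  rw [refDir, rotation_dotProduct, vec_sphericalPoint]
  simp [dotProduct, Fin.sum_univ_three]
  ring

/-- The unit tangent vector in the direction of increasing colatitude. -/
def thetaDir (R : SO3) (p : S2) : Fin 3 → ℝ := refDir R p ⨯₃ vec p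

theorem thetaDir_coordPoint (R : SO3) {θ : ℝ} (hθ : 0 < Real.sin θ) (φ : ℝ) :
    thetaDir R (coordPoint R θ φ) = R.1 *ᵥ
      ![Real.cos θ * Real.cos φ, Real.cos θ * Real.sin φ, -Real.sin θ] := by
  rw [thetaDir, refDir_coordPoint R hθ, coordPoint, vec_rot, mulVec_cross, vec_sphericalPoint]
  congr 1
  ext i
  fin_cases i <;> simp [cross_apply]
  · ring
  · ring
  · linear_combination -Real.sin θ * Real.sin_sq_add_cos_sq φ

/-! ### The generating families -/

/-- The Cartesian coordinates, as spin `0` functions. -/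
def posFam (i : Fin 3) : Family := fun _ p => (vec p.1 i : ℂ)

/-- The components of the null vector `e_θ + i e_φ`, spin `1` functions. -/
def nullFam (i : Fin 3) : Family := fun R p =>
  (thetaDir R p.1 i : ℂ) + Complex.I * (refDir R p.1 i : ℂ)

theorem posFam_sum_sq : posFam 0 * posFam 0 + posFam 1 * posFam 1 + posFam 2 * posFam 2 = 1 := by
  ext R p
  have h := vec_sq_sum p.1
  simp only [posFam, Pi.add_apply, Pi.mul_apply, Pi.one_apply]
  have h2 : ((vec p.1 0 ^ 2 + vec p.1 1 ^ 2 + vec p.1 2 ^ 2 : ℝ) : ℂ) = 1 := by rw [h]; simp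
  push_cast at h2
  linear_combination h2

theorem star_posFam (i : Fin 3) : star (posFam i) = posFam i := by
  ext R p
  simp [posFam]

/-- `p × m = -i m` for the null vector `m`. -/
theorem posFam_cross_nullFam :
    posFam 1 * nullFam 2 - posFam 2 * nullFam 1 = (-Complex.I) • nullFam 0 ∧
    posFam 2 * nullFam 0 - posFam 0 * nullFam 2 = (-Complex.I) • nullFam 1 ∧
    posFam 0 * nullFam 1 - posFam 1 * nullFam 0 = (-Complex.I) • nullFam 2 := by
  have key : ∀ (R : SO3) (p : chart R), vec p.1 ⨯₃ thetaDir R p.1 = refDir R p.1 := fun R p =>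
    cross_frame_swap _ _ (vec_dotProduct_self p.1) (refDir_dotProduct_vec R p.2)
  have key2 : ∀ (R : SO3) (p : chart R), vec p.1 ⨯₃ refDir R p.1 = -thetaDir R p.1 := fun R p => by
    rw [thetaDir, cross_anticomm]
  refine ⟨?_, ?_, ?_⟩
  all_goals
    ext R p
    have h1 := key R p
    have h2 := key2 R p
    rw [cross_apply] at h1 h2
    simp only [posFam, nullFam, Pi.sub_apply, Pi.mul_apply, Pi.smul_apply, smul_eq_mul]
  · have h1 := congrArg (fun x : ℝ => (x : ℂ)) (congrFun h1 0)
    have h2 := congrArg (fun x : ℝ => (x : ℂ)) (congrFun h2 0)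
    simp at h1 h2
    linear_combination h1 + Complex.I * h2 + (refDir R p.1 0 : ℂ) * Complex.I_sq
  · have h1 := congrArg (fun x : ℝ => (x : ℂ)) (congrFun h1 1)
    have h2 := congrArg (fun x : ℝ => (x : ℂ)) (congrFun h2 1)
    simp at h1 h2
    linear_combination h1 + Complex.I * h2 + (refDir R p.1 1 : ℂ) * Complex.I_sq
  · have h1 := congrArg (fun x : ℝ => (x : ℂ)) (congrFun h1 2)
    have h2 := congrArg (fun x : ℝ => (x : ℂ)) (congrFun h2 2)
    simp at h1 h2
    linear_combination h1 + Complex.I * h2 + (refDir R p.1 2 : ℂ) * Complex.I_sq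

/-- The symmetric part of `m_i conj m_j` is the projection onto the tangent plane, which frame
completeness expresses through the position alone. -/
theorem nullFam_mul_star_self (i j : Fin 3) :
    nullFam i * star (nullFam j) + nullFam j * star (nullFam i) =
      (if i = j then (2 : ℂ) else 0) • 1 - (2 : ℂ) • (posFam i * posFam j) := by
  ext R p
  have h := frame_complete (refDir R p.1) (vec p.1) (refDir_dotProduct_self R p.1)
    (vec_dotProduct_self p.1) (refDir_dotProduct_vec R p.2) i j
  have h2 := congrArg (fun x : ℝ => (x : ℂ)) h
  simp only [posFam, nullFam, thetaDir, Pi.sub_apply, Pi.add_apply, Pi.mul_apply, Pi.smul_apply,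
    Pi.star_apply, smul_eq_mul, Pi.one_apply]
  simp
  have h3 : (if i = j then (2 : ℂ) else 0) = 2 * ((if i = j then 1 else 0 : ℝ) : ℂ) := by
    split_ifs <;> simp
  rw [h3, ← h2]
  push_cast
  linear_combination -2 * (refDir R p.1 i : ℂ) * (refDir R p.1 j : ℂ) * Complex.I_sq

/-- The antisymmetric part is `m × conj m = -2i e_θ × e_φ = -2i p`. -/
theorem nullFam_mul_star_antisymm :
    nullFam 1 * star (nullFam 2) - nullFam 2 * star (nullFam 1) = (-2 * Complex.I) • posFam 0 ∧
    nullFam 2 * star (nullFam 0) - nullFam 0 * star (nullFam 2) = (-2 * Complex.I) • posFam 1 ∧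
    nullFam 0 * star (nullFam 1) - nullFam 1 * star (nullFam 0) = (-2 * Complex.I) • posFam 2 := by
  have key : ∀ (R : SO3) (p : chart R), refDir R p.1 ⨯₃ thetaDir R p.1 = - vec p.1 := fun R p => by
    have h := cross_cross_eq_smul_sub_smul' (refDir R p.1) (refDir R p.1) (vec p.1)
    rw [thetaDir, h, refDir_dotProduct_self, refDir_dotProduct_vec R p.2]
    simp
  refine ⟨?_, ?_, ?_⟩
  all_goals
    ext R p
    have h1 := key R p
    rw [cross_apply] at h1
    simp only [posFam, nullFam, Pi.sub_apply, Pi.mul_apply, Pi.smul_apply, smul_eq_mul,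
      Pi.star_apply]
  · have h1 := congrArg (fun x : ℝ => (x : ℂ)) (congrFun h1 0)
    simp at h1 ⊢
    linear_combination (2 * Complex.I) * h1
  · have h1 := congrArg (fun x : ℝ => (x : ℂ)) (congrFun h1 1)
    simp at h1 ⊢
    linear_combination (2 * Complex.I) * h1
  · have h1 := congrArg (fun x : ℝ => (x : ℂ)) (congrFun h1 2)
    simp at h1 ⊢
    linear_combination (2 * Complex.I) * h1

/-! ### Smooth spin functions -/

theorem contMDiff_mul_complex {R : SO3} {f g : chart R → ℂ} (hf : ContMDiff (𝓡 2) 𝓘(ℝ, ℂ) ∞ f)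
    (hg : ContMDiff (𝓡 2) 𝓘(ℝ, ℂ) ∞ g) : ContMDiff (𝓡 2) 𝓘(ℝ, ℂ) ∞ (f * g) :=
  (contDiff_mul (𝕜 := ℝ) (𝔸 := ℂ)).contMDiff.comp (hf.prodMk_space hg)

theorem IsSmoothSpin.zero (s : ℤ) : IsSmoothSpin s 0 where
  smooth _ := contMDiff_const
  transition _ _ _ _ _ := by simp

theorem IsSmoothSpin.one : IsSmoothSpin 0 1 where
  smooth _ := contMDiff_const
  transition _ _ _ _ _ := by simp

theorem IsSmoothSpin.add {s : ℤ} {F G : Family} (hF : IsSmoothSpin s F) (hG : IsSmoothSpin s G) :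
    IsSmoothSpin s (F + G) where
  smooth R := (hF.smooth R).add (hG.smooth R)
  transition R₁ R₂ p h₁ h₂ := by
    simp only [Pi.add_apply, hF.transition R₁ R₂ p h₁ h₂, hG.transition R₁ R₂ p h₁ h₂]
    ring

theorem IsSmoothSpin.smul {s : ℤ} {F : Family} (c : ℂ) (hF : IsSmoothSpin s F) :
    IsSmoothSpin s (c • F) where
  smooth R := contMDiff_mul_complex (contMDiff_const (c := c)) (hF.smooth R)
  transition R₁ R₂ p h₁ h₂ := by
    simp only [Pi.smul_apply, hF.transition R₁ R₂ p h₁ h₂, smul_eq_mul]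
    ring

theorem IsSmoothSpin.mul {r s : ℤ} {F G : Family} (hF : IsSmoothSpin r F)
    (hG : IsSmoothSpin s G) : IsSmoothSpin (r + s) (F * G) where
  smooth R := contMDiff_mul_complex (hF.smooth R) (hG.smooth R)
  transition R₁ R₂ p h₁ h₂ := by
    simp only [Pi.mul_apply, hF.transition R₁ R₂ p h₁ h₂, hG.transition R₁ R₂ p h₁ h₂]
    push_cast
    rw [mul_add, add_mul, Complex.exp_add]
    ring

theorem IsSmoothSpin.star {s : ℤ} {F : Family} (hF : IsSmoothSpin s F) :
    IsSmoothSpin (-s) (star F) where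
  smooth R := Complex.conjCLE.contDiff.contMDiff.comp (hF.smooth R)
  transition R₁ R₂ p h₁ h₂ := by
    simp only [Pi.star_apply, hF.transition R₁ R₂ p h₁ h₂, star_mul']
    congr 1
    rw [Complex.star_def, ← Complex.exp_conj]
    simp

theorem contMDiff_vec (i : Fin 3) : ContMDiff (𝓡 2) 𝓘(ℝ, ℝ) ∞ (fun p : S2 => vec p i) := by
  have h : ContMDiff (𝓡 2) 𝓘(ℝ, EuclideanSpace ℝ (Fin 3)) ∞
      ((↑) : S2 → EuclideanSpace ℝ (Fin 3)) := by
    have : Fact (Module.finrank ℝ (EuclideanSpace ℝ (Fin 3)) = 2 + 1) :=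
      ⟨finrank_euclideanSpace_fin⟩
    exact contMDiff_coe_sphere
  exact (EuclideanSpace.proj (𝕜 := ℝ) i).contDiff.contMDiff.comp h

theorem contMDiff_vec_chart (R : SO3) (i : Fin 3) :
    ContMDiff (𝓡 2) 𝓘(ℝ, ℝ) ∞ (fun p : chart R => vec p.1 i) :=
  (contMDiff_vec i).comp contMDiff_subtype_val

theorem contMDiff_mulVec {R : SO3} (N : Matrix (Fin 3) (Fin 3) ℝ) {f : chart R → Fin 3 → ℝ}
    (hf : ∀ i, ContMDiff (𝓡 2) 𝓘(ℝ, ℝ) ∞ (fun p => f p i)) (i : Fin 3) :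
    ContMDiff (𝓡 2) 𝓘(ℝ, ℝ) ∞ (fun p => (N *ᵥ f p) i) := by
  simp only [Matrix.mulVec, dotProduct, Fin.sum_univ_three]
  exact ((contMDiff_const.mul (hf 0)).add (contMDiff_const.mul (hf 1))).add
    (contMDiff_const.mul (hf 2))

/-- The longitude jumps, but its cosine and sine are Cartesian coordinates divided by the
nonvanishing distance from the axis. -/
theorem contMDiff_refDir (R : SO3) (i : Fin 3) :
    ContMDiff (𝓡 2) 𝓘(ℝ, ℝ) ∞ (fun p : chart R => refDir R p.1 i) := by
  have hq : ∀ i, ContMDiff (𝓡 2) 𝓘(ℝ, ℝ) ∞ (fun p : chart R => vec (rot R⁻¹ p.1) i) :=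
    contMDiff_mulVec _ (contMDiff_vec_chart R)
  have hd : ContMDiff (𝓡 2) 𝓘(ℝ, ℝ) ∞ (fun p : chart R => (axisDist R p.1)⁻¹) := by
    refine ContMDiff.inv₀ (fun p => ?_) (fun p => (axisDist_pos R p.2).ne')
    have hpos := (mem_chart_iff R p.1).1 p.2
    refine ContMDiffAt.comp (I' := 𝓘(ℝ, ℝ)) p (Real.contDiffAt_sqrt hpos.ne').contMDiffAt ?_
    exact (((hq 0).pow 2).add ((hq 1).pow 2)).contMDiffAt
  refine contMDiff_mulVec R.1 (f := fun p : chart R =>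
    ![-Real.sin (longitude R p.1), Real.cos (longitude R p.1), 0]) (fun j => ?_) i
  fin_cases j
  · have h : (fun p : chart R => -Real.sin (longitude R p.1)) =
        fun p : chart R => -(vec (rot R⁻¹ p.1) 1 * (axisDist R p.1)⁻¹) := by
      ext p
      rw [sin_longitude, div_eq_mul_inv]
    exact h ▸ ((hq 1).mul hd).neg
  · have h : (fun p : chart R => Real.cos (longitude R p.1)) =
        fun p : chart R => vec (rot R⁻¹ p.1) 0 * (axisDist R p.1)⁻¹ := by
      ext p
      rw [cos_longitude R p.2, div_eq_mul_inv]
    exact h ▸ (hq 0).mul hd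
  · exact contMDiff_const

theorem contMDiff_thetaDir (R : SO3) (i : Fin 3) :
    ContMDiff (𝓡 2) 𝓘(ℝ, ℝ) ∞ (fun p : chart R => thetaDir R p.1 i) := by
  have hu := contMDiff_refDir R
  have hp := contMDiff_vec_chart R
  simp only [thetaDir, cross_apply]
  fin_cases i
  · exact ((hu 1).mul (hp 2)).sub ((hu 2).mul (hp 1))
  · exact ((hu 2).mul (hp 0)).sub ((hu 0).mul (hp 2))
  · exact ((hu 0).mul (hp 1)).sub ((hu 1).mul (hp 0))

theorem isSmoothSpin_posFam (i : Fin 3) : IsSmoothSpin 0 (posFam i) where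
  smooth R := Complex.ofRealCLM.contDiff.contMDiff.comp (contMDiff_vec_chart R i)
  transition _ _ _ _ _ := by simp [posFam]

/-- The complex number whose argument defines the angle has modulus one, by `tangent_normSq`. -/
theorem exp_orientedAngle {R₁ R₂ : SO3} {p : S2} (h₁ : p ∈ chart R₁) (h₂ : p ∈ chart R₂) :
    Complex.exp (Complex.I * orientedAngle p R₂ R₁) =
      ⟨refDir R₁ p ⬝ᵥ refDir R₂ p, -vec p ⬝ᵥ (refDir R₁ p ⨯₃ refDir R₂ p)⟩ := by
  set c : ℂ := ⟨refDir R₁ p ⬝ᵥ refDir R₂ p, -vec p ⬝ᵥ (refDir R₁ p ⨯₃ refDir R₂ p)⟩ with hc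
  have hn : ‖c‖ = 1 := by
    rw [Complex.norm_eq_sqrt_sq_add_sq, hc]
    simp only
    rw [tangent_normSq _ _ _ (refDir_dotProduct_self R₁ p) (vec_dotProduct_self p)
      (refDir_dotProduct_self R₂ p) (refDir_dotProduct_vec R₁ h₁) (refDir_dotProduct_vec R₂ h₂),
      Real.sqrt_one]
  have h := Complex.norm_mul_exp_arg_mul_I c
  rw [hn, Complex.ofReal_one, one_mul, mul_comm] at h
  exact h

/-- If `a + ib` is the exponential of the transition angle, the two tangent expansions combine to
`m_{R₂} = (a + ib) m_{R₁}`. -/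
theorem isSmoothSpin_nullFam (i : Fin 3) : IsSmoothSpin 1 (nullFam i) where
  smooth R :=
    (Complex.ofRealCLM.contDiff.contMDiff.comp (contMDiff_thetaDir R i)).add
      (contMDiff_mul_complex (contMDiff_const (c := Complex.I)) (Complex.ofRealCLM.contDiff.contMDiff.comp (contMDiff_refDir R i)))
  transition R₁ R₂ p h₁ h₂ := by
    have hu := refDir_dotProduct_self R₁ p
    have hp := vec_dotProduct_self p
    have hup := refDir_dotProduct_vec R₁ h₁
    have hvp := refDir_dotProduct_vec R₂ h₂
    simp only [Int.cast_one, mul_one, nullFam, thetaDir]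
    rw [exp_orientedAngle h₁ h₂, tangent_expand _ (refDir R₂ p) _ hu hp hup hvp i,
      tangent_cross_expand _ (refDir R₂ p) _ hu hp hup hvp i]
    apply Complex.ext <;> simp

/-! ### Functions in spherical coordinates -/

theorem inCoords_of_mem (R : SO3) (f : chart R → ℂ) {θ φ : ℝ} (h : coordPoint R θ φ ∈ chart R) :
    inCoords R f θ φ = f ⟨coordPoint R θ φ, h⟩ :=
  Subtype.val_injective.extend_apply f 0 ⟨coordPoint R θ φ, h⟩

theorem inCoords_of_notMem (R : SO3) (f : chart R → ℂ) {θ φ : ℝ}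
    (h : coordPoint R θ φ ∉ chart R) : inCoords R f θ φ = 0 := by
  rw [inCoords, Function.extend_apply']
  · rfl
  · rintro ⟨a, ha⟩
    exact h (ha ▸ a.2)

theorem inCoords_colatitude_longitude (R : SO3) (f : chart R → ℂ) (p : chart R) :
    inCoords R f (colatitude R p.1) (longitude R p.1) = f p := by
  have h := coordPoint_colatitude_longitude R p.2
  rw [inCoords, h]
  exact Subtype.val_injective.extend_apply f 0 p

theorem inCoords_add (R : SO3) (f g : chart R → ℂ) (θ φ : ℝ) :
    inCoords R (f + g) θ φ = inCoords R f θ φ + inCoords R g θ φ := by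
  by_cases h : coordPoint R θ φ ∈ chart R
  · simp only [inCoords_of_mem R _ h, Pi.add_apply]
  · simp only [inCoords_of_notMem R _ h, add_zero]

theorem inCoords_mul (R : SO3) (f g : chart R → ℂ) (θ φ : ℝ) :
    inCoords R (f * g) θ φ = inCoords R f θ φ * inCoords R g θ φ := by
  by_cases h : coordPoint R θ φ ∈ chart R
  · simp only [inCoords_of_mem R _ h, Pi.mul_apply]
  · simp only [inCoords_of_notMem R _ h, mul_zero]

theorem inCoords_smul (R : SO3) (c : ℂ) (f : chart R → ℂ) (θ φ : ℝ) :
    inCoords R (c • f) θ φ = c * inCoords R f θ φ := by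
  by_cases h : coordPoint R θ φ ∈ chart R
  · simp only [inCoords_of_mem R _ h, Pi.smul_apply, smul_eq_mul]
  · simp only [inCoords_of_notMem R _ h, mul_zero]

theorem inCoords_star (R : SO3) (f : chart R → ℂ) (θ φ : ℝ) :
    inCoords R (star f) θ φ = star (inCoords R f θ φ) := by
  by_cases h : coordPoint R θ φ ∈ chart R
  · simp only [inCoords_of_mem R _ h, Pi.star_apply]
  · simp only [inCoords_of_notMem R _ h, star_zero]

/-! ### The spin-raising operator on differentiable families -/

/-- `F` is differentiable in all spherical coordinates, and `G` is the result of raising `F`,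
regarded as a spin `s` function. -/
def HasEth (s : ℤ) (F G : Family) : Prop :=
  ∀ (R : SO3) (p : chart R), ∃ a b : ℂ,
    HasDerivAt (fun t => inCoords R (F R) t (longitude R p.1)) a (colatitude R p.1) ∧
    HasDerivAt (fun u => inCoords R (F R) (colatitude R p.1) u) b (longitude R p.1) ∧
    G R p = -(a + Complex.I / (Real.sin (colatitude R p.1) : ℂ) * b) +
      s * ((Real.cos (colatitude R p.1) : ℂ) / (Real.sin (colatitude R p.1) : ℂ)) * F R p

theorem sin_colatitude_pos (R : SO3) (p : chart R) : 0 < Real.sin (colatitude R p.1) := by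
  rw [sin_colatitude]
  exact axisDist_pos R p.2

/-- Differentiating the weight `sin^(-s)` produces the term `s cot θ F`; elsewhere the two weights
cancel. The relation `HasEth` records differentiability, without which `deriv` is not additive. -/
theorem HasEth.eth_eq {s : ℤ} {F G : Family} (h : HasEth s F G) : eth s F = G := by
  ext R p
  obtain ⟨a, b, ha, hb, hG⟩ := h R p
  have hF := inCoords_colatitude_longitude R (F R) p
  rw [hG, eth]
  set θ := colatitude R p.1
  set φ := longitude R p.1
  have hsin : (Real.sin θ : ℂ) ≠ 0 := by exact_mod_cast (sin_colatitude_pos R p).ne'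
  have h1 : HasDerivAt (fun t : ℝ => (Real.sin t : ℂ) ^ (-s))
      ((-s : ℤ) * (Real.sin θ : ℂ) ^ (-s - 1) * (Real.cos θ : ℂ)) θ :=
    HasDerivAt.comp (h₂ := fun z : ℂ => z ^ (-s)) (h := fun t : ℝ => (Real.sin t : ℂ)) θ
      (hasDerivAt_zpow (-s) (Real.sin θ : ℂ) (Or.inl hsin)) (Real.hasDerivAt_sin θ).ofReal_comp
  have h2 : HasDerivAt (fun t : ℝ => (Real.sin t : ℂ) ^ (-s) * inCoords R (F R) t φ) _ θ :=
    h1.mul ha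
  rw [h2.deriv, (hb.const_mul ((Real.sin θ : ℂ) ^ (-s))).deriv, hF, zpow_sub_one₀ hsin]
  have hinv : (Real.sin θ : ℂ) ^ s * (Real.sin θ : ℂ) ^ (-s) = 1 := by
    rw [← zpow_add₀ hsin]
    simp
  rw [Int.cast_neg]
  linear_combination ((s : ℂ) * (Real.sin θ : ℂ)⁻¹ * (Real.cos θ : ℂ) * F R p - a -
    Complex.I / (Real.sin θ : ℂ) * b) * hinv

theorem HasEth.add {s : ℤ} {F F' G G' : Family} (h : HasEth s F G) (h' : HasEth s F' G') :
    HasEth s (F + F') (G + G') := by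
  intro R p
  obtain ⟨a, b, ha, hb, hG⟩ := h R p
  obtain ⟨a', b', ha', hb', hG'⟩ := h' R p
  refine ⟨a + a', b + b', ?_, ?_, ?_⟩
  · simp only [Pi.add_apply, inCoords_add]
    exact ha.add ha'
  · simp only [Pi.add_apply, inCoords_add]
    exact hb.add hb'
  · simp only [Pi.add_apply, hG, hG']
    ring

theorem HasEth.smul {s : ℤ} {F G : Family} (c : ℂ) (h : HasEth s F G) :
    HasEth s (c • F) (c • G) := by
  intro R p
  obtain ⟨a, b, ha, hb, hG⟩ := h R p
  refine ⟨c * a, c * b, ?_, ?_, ?_⟩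
  · simpa only [Pi.smul_apply, inCoords_smul] using ha.const_mul c
  · simpa only [Pi.smul_apply, inCoords_smul] using hb.const_mul c
  · simp only [Pi.smul_apply, hG, smul_eq_mul]
    ring

/-- The derivative part is a derivation and the term `s cot θ` is additive in the spin, so the
Leibniz rule holds with spins added. -/
theorem HasEth.mul {r s : ℤ} {F F' G G' : Family} (h : HasEth r F G) (h' : HasEth s F' G') :
    HasEth (r + s) (F * F') (G * F' + F * G') := by
  intro R p
  obtain ⟨a, b, ha, hb, hG⟩ := h R p
  obtain ⟨a', b', ha', hb', hG'⟩ := h' R p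
  have hF := inCoords_colatitude_longitude R (F R) p
  have hF' := inCoords_colatitude_longitude R (F' R) p
  refine ⟨a * F' R p + F R p * a', b * F' R p + F R p * b', ?_, ?_, ?_⟩
  · have := ha.mul ha'
    rw [hF, hF'] at this
    simp only [Pi.mul_apply, inCoords_mul]
    exact this
  · have := hb.mul hb'
    rw [hF, hF'] at this
    simp only [Pi.mul_apply, inCoords_mul]
    exact this
  · simp only [Pi.mul_apply, Pi.add_apply, hG, hG']
    push_cast
    ring

theorem eventually_inCoords_theta (R : SO3) (p : chart R) (f : chart R → ℂ) (g : ℝ → ℂ)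
    (hfg : ∀ (t : ℝ) (ht : 0 < Real.sin t), f ⟨coordPoint R t (longitude R p.1),
      coordPoint_mem_chart R ht.ne' _⟩ = g t) :
    (fun t => inCoords R f t (longitude R p.1)) =ᶠ[nhds (colatitude R p.1)] g := by
  have h := Real.continuous_sin.continuousAt.eventually
    (lt_mem_nhds (sin_colatitude_pos R p))
  filter_upwards [h] with t ht
  rw [inCoords_of_mem R f (coordPoint_mem_chart R ht.ne' _), hfg t ht]

theorem inCoords_phi (R : SO3) (p : chart R) (f : chart R → ℂ) (g : ℝ → ℂ)
    (hfg : ∀ u : ℝ, f ⟨coordPoint R (colatitude R p.1) u,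
      coordPoint_mem_chart R (sin_colatitude_pos R p).ne' _⟩ = g u) :
    (fun u => inCoords R f (colatitude R p.1) u) = g := by
  ext u
  rw [inCoords_of_mem R f (coordPoint_mem_chart R (sin_colatitude_pos R p).ne' _), hfg u]

theorem hasDerivAt_mulVec (N : Matrix (Fin 3) (Fin 3) ℝ) {x y z : ℝ → ℝ} {x' y' z' t : ℝ}
    (hx : HasDerivAt x x' t) (hy : HasDerivAt y y' t) (hz : HasDerivAt z z' t) (i : Fin 3) :
    HasDerivAt (fun t => (((N *ᵥ ![x t, y t, z t]) i : ℝ) : ℂ))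
      (((N *ᵥ ![x', y', z']) i : ℝ) : ℂ) t := by
  refine HasDerivAt.ofReal_comp ?_
  simp only [Matrix.mulVec, dotProduct, Fin.sum_univ_three, Matrix.cons_val]
  exact ((hx.const_mul _).add (hy.const_mul _)).add (hz.const_mul _)

theorem vec_eq_of_chart (R : SO3) (p : chart R) : vec p.1 = R.1 *ᵥ
    ![Real.sin (colatitude R p.1) * Real.cos (longitude R p.1),
      Real.sin (colatitude R p.1) * Real.sin (longitude R p.1), Real.cos (colatitude R p.1)] := by
  conv_lhs => rw [← coordPoint_colatitude_longitude R p.2]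
  rfl

theorem thetaDir_eq_of_chart (R : SO3) (p : chart R) : thetaDir R p.1 = R.1 *ᵥ
    ![Real.cos (colatitude R p.1) * Real.cos (longitude R p.1),
      Real.cos (colatitude R p.1) * Real.sin (longitude R p.1),
      -Real.sin (colatitude R p.1)] := by
  conv_lhs => rw [← coordPoint_colatitude_longitude R p.2]
  exact thetaDir_coordPoint R (sin_colatitude_pos R p) _

theorem hasEth_one : HasEth 0 1 0 := by
  intro R p
  refine ⟨0, 0, ?_, ?_, by simp⟩
  · exact (hasDerivAt_const _ (1 : ℂ)).congr_of_eventuallyEq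
      (eventually_inCoords_theta R p _ _ fun _ _ => rfl)
  · rw [inCoords_phi R p _ (fun _ => 1) fun _ => rfl]
    exact hasDerivAt_const _ _

/-- Here `∂p/∂θ = e_θ` and `∂p/∂φ = sin θ e_φ`. -/
theorem hasEth_posFam (i : Fin 3) : HasEth 0 (posFam i) (-nullFam i) := by
  intro R p
  have hsin := sin_colatitude_pos R p
  have hsin' : (Real.sin (colatitude R p.1) : ℂ) ≠ 0 := by exact_mod_cast hsin.ne'
  refine ⟨(thetaDir R p.1 i : ℂ), ((Real.sin (colatitude R p.1) * refDir R p.1 i : ℝ) : ℂ),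
    ?_, ?_, ?_⟩
  · refine HasDerivAt.congr_of_eventuallyEq ?_
      (eventually_inCoords_theta R p (posFam i R)
        (fun t => (((R.1 *ᵥ ![Real.sin t * Real.cos (longitude R p.1),
          Real.sin t * Real.sin (longitude R p.1), Real.cos t]) i : ℝ) : ℂ)) fun t _ => rfl)
    rw [thetaDir_eq_of_chart]
    exact hasDerivAt_mulVec R.1 ((Real.hasDerivAt_sin _).mul_const _)
      ((Real.hasDerivAt_sin _).mul_const _) (Real.hasDerivAt_cos _) i
  · rw [inCoords_phi R p (posFam i R)
      (fun u => (((R.1 *ᵥ ![Real.sin (colatitude R p.1) * Real.cos u,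
        Real.sin (colatitude R p.1) * Real.sin u, Real.cos (colatitude R p.1)]) i : ℝ) : ℂ))
      fun u => rfl]
    have h := hasDerivAt_mulVec R.1
      ((Real.hasDerivAt_cos (longitude R p.1)).const_mul (Real.sin (colatitude R p.1)))
      ((Real.hasDerivAt_sin (longitude R p.1)).const_mul (Real.sin (colatitude R p.1)))
      (hasDerivAt_const (longitude R p.1) (Real.cos (colatitude R p.1))) i
    convert h using 2
    simp only [refDir, Matrix.mulVec, dotProduct, Fin.sum_univ_three, Matrix.cons_val]
    ring
  · simp only [nullFam, Pi.neg_apply]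
    push_cast at hsin' ⊢
    field_simp
    ring

/-- Here `∂m/∂θ = -p` and `∂m/∂φ = cos θ e_φ - i (sin θ p + cos θ e_θ)`. The two occurrences of `p`
cancel, and what remains is cancelled by `cot θ m`. -/
theorem hasEth_nullFam (i : Fin 3) : HasEth 1 (nullFam i) 0 := by
  intro R p
  have hsin := sin_colatitude_pos R p
  have hsin' : (Real.sin (colatitude R p.1) : ℂ) ≠ 0 := by exact_mod_cast hsin.ne'
  refine ⟨((-vec p.1 i : ℝ) : ℂ), ((Real.cos (colatitude R p.1) * refDir R p.1 i : ℝ) : ℂ) +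
    Complex.I * ((-(Real.sin (colatitude R p.1) * vec p.1 i +
      Real.cos (colatitude R p.1) * thetaDir R p.1 i) : ℝ) : ℂ), ?_, ?_, ?_⟩
  · refine HasDerivAt.congr_of_eventuallyEq ?_
      (eventually_inCoords_theta R p (nullFam i R)
        (fun t => (((R.1 *ᵥ ![Real.cos t * Real.cos (longitude R p.1),
            Real.cos t * Real.sin (longitude R p.1), -Real.sin t]) i : ℝ) : ℂ) +
          Complex.I * (((R.1 *ᵥ ![-Real.sin (longitude R p.1),
            Real.cos (longitude R p.1), 0]) i : ℝ) : ℂ)) fun t ht => ?_)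
    · have h := (hasDerivAt_mulVec R.1
        ((Real.hasDerivAt_cos (colatitude R p.1)).mul_const (Real.cos (longitude R p.1)))
        ((Real.hasDerivAt_cos (colatitude R p.1)).mul_const (Real.sin (longitude R p.1)))
        (Real.hasDerivAt_sin (colatitude R p.1)).neg i).add_const
        (Complex.I * (((R.1 *ᵥ ![-Real.sin (longitude R p.1),
            Real.cos (longitude R p.1), 0]) i : ℝ) : ℂ))
      have hv : -vec p.1 i = (R.1 *ᵥ ![-Real.sin (colatitude R p.1) * Real.cos (longitude R p.1),
          -Real.sin (colatitude R p.1) * Real.sin (longitude R p.1),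
          -Real.cos (colatitude R p.1)]) i := by
        rw [vec_eq_of_chart]
        simp only [Matrix.mulVec, dotProduct, Fin.sum_univ_three, Matrix.cons_val]
        ring
      rw [hv]
      exact h
    · simp only [nullFam]
      rw [thetaDir_coordPoint R ht, refDir_coordPoint R ht]
  · rw [inCoords_phi R p (nullFam i R)
        (fun u => (((R.1 *ᵥ ![Real.cos (colatitude R p.1) * Real.cos u,
            Real.cos (colatitude R p.1) * Real.sin u, -Real.sin (colatitude R p.1)]) i : ℝ) : ℂ) +
          Complex.I * (((R.1 *ᵥ ![-Real.sin u, Real.cos u, 0]) i : ℝ) : ℂ)) fun u => ?_]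
    · have h1 := hasDerivAt_mulVec R.1
        ((Real.hasDerivAt_cos (longitude R p.1)).const_mul (Real.cos (colatitude R p.1)))
        ((Real.hasDerivAt_sin (longitude R p.1)).const_mul (Real.cos (colatitude R p.1)))
        (hasDerivAt_const (longitude R p.1) (-Real.sin (colatitude R p.1))) i
      have h2 := hasDerivAt_mulVec R.1 (Real.hasDerivAt_sin (longitude R p.1)).neg
        (Real.hasDerivAt_cos (longitude R p.1)) (hasDerivAt_const (longitude R p.1) 0) i
      have hu : Real.cos (colatitude R p.1) * refDir R p.1 i = (R.1 *ᵥ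
          ![Real.cos (colatitude R p.1) * -Real.sin (longitude R p.1),
            Real.cos (colatitude R p.1) * Real.cos (longitude R p.1), 0]) i := by
        simp only [refDir, Matrix.mulVec, dotProduct, Fin.sum_univ_three, Matrix.cons_val]
        ring
      have hv : -(Real.sin (colatitude R p.1) * vec p.1 i +
          Real.cos (colatitude R p.1) * thetaDir R p.1 i) =
          (R.1 *ᵥ ![-Real.cos (longitude R p.1), -Real.sin (longitude R p.1), 0]) i := by
        rw [vec_eq_of_chart, thetaDir_eq_of_chart]
        simp only [Matrix.mulVec, dotProduct, Fin.sum_univ_three, Matrix.cons_val]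
        linear_combination (-R.1 i 0 * Real.cos (longitude R p.1) -
          R.1 i 1 * Real.sin (longitude R p.1)) *
          Real.sin_sq_add_cos_sq (colatitude R p.1)
      rw [hu, hv]
      exact h1.add (h2.const_mul Complex.I)
    · simp only [nullFam]
      rw [thetaDir_coordPoint R hsin, refDir_coordPoint R hsin]
  · simp only [nullFam, Pi.zero_apply]
    push_cast at hsin' ⊢
    field_simp
    linear_combination -((Complex.sin (colatitude R p.1 : ℂ)) * (vec p.1 i : ℂ) +
      (Complex.cos (colatitude R p.1 : ℂ)) * (thetaDir R p.1 i : ℂ)) * Complex.I_sq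

/-! ### Conjugation -/

/-- No differentiability is needed: `deriv` commutes with conjugation even at its default value. -/
theorem ethBar_star (s : ℤ) (F : Family) : ethBar (-s) (star F) = star (eth s F) := by
  ext R p
  have h1 : ∀ (x : ℝ) (k : ℤ) (z : ℂ), (x : ℂ) ^ k * star z = star ((x : ℂ) ^ k * z) := by
    intro x k z
    simp only [star_mul', star_zpow₀, Complex.star_def, Complex.conj_ofReal]
  simp only [ethBar, eth, Pi.star_apply, inCoords_star, neg_neg, h1, deriv.star]
  simp only [star_mul', star_add, star_neg, star_div₀, star_zpow₀, Complex.star_def,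
    Complex.conj_ofReal, Complex.conj_I]
  ring

/-! ### Polynomial spin functions -/

/-- Polynomials of degree at most one in the position. -/
def posSpace : Submodule ℂ Family := Submodule.span ℂ (insert 1 (Set.range posFam))

/-- Linear forms in the null vector. -/
def nullSpace : Submodule ℂ Family := Submodule.span ℂ (Set.range nullFam)

/-- Linear forms in the conjugate null vector. -/
def nullStarSpace : Submodule ℂ Family := Submodule.span ℂ (Set.range (star nullFam))

theorem one_mem_posSpace : (1 : Family) ∈ posSpace := Submodule.subset_span (Set.mem_insert _ _)

theorem posFam_mem (i : Fin 3) : posFam i ∈ posSpace :=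
  Submodule.subset_span (Set.mem_insert_of_mem _ (Set.mem_range_self i))

theorem nullFam_mem (i : Fin 3) : nullFam i ∈ nullSpace :=
  Submodule.subset_span (Set.mem_range_self i)

theorem star_nullFam_mem (i : Fin 3) : star (nullFam i) ∈ nullStarSpace :=
  Submodule.subset_span (Set.mem_range_self i)

theorem posSpace_pow_mono {d e : ℕ} (h : d ≤ e) : posSpace ^ d ≤ posSpace ^ e :=
  pow_le_pow_right' (Submodule.one_le.2 one_mem_posSpace) h

/-- These differences are, up to sign, the components of `p × m = -i m`: exchanging the indices of
`p_i m_j` costs only a term of lower degree. -/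
theorem posFam_mul_nullFam_sub (i j : Fin 3) :
    posFam i * nullFam j - posFam j * nullFam i ∈ nullSpace := by
  obtain ⟨h0, h1, h2⟩ := posFam_cross_nullFam
  have e0 := nullSpace.smul_mem (-Complex.I) (nullFam_mem 0)
  have e1 := nullSpace.smul_mem (-Complex.I) (nullFam_mem 1)
  have e2 := nullSpace.smul_mem (-Complex.I) (nullFam_mem 2)
  rw [← h0] at e0
  rw [← h1] at e1
  rw [← h2] at e2
  fin_cases i <;> fin_cases j
  · simp
  · exact e2
  · simpa using nullSpace.neg_mem e1
  · simpa using nullSpace.neg_mem e2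
  · simp
  · exact e0
  · exact e1
  · simpa using nullSpace.neg_mem e0
  · simp

theorem nullFam_mul_star_sub (i j : Fin 3) :
    nullFam i * star (nullFam j) - nullFam j * star (nullFam i) ∈ posSpace := by
  obtain ⟨h0, h1, h2⟩ := nullFam_mul_star_antisymm
  have e0 := posSpace.smul_mem (-2 * Complex.I) (posFam_mem 0)
  have e1 := posSpace.smul_mem (-2 * Complex.I) (posFam_mem 1)
  have e2 := posSpace.smul_mem (-2 * Complex.I) (posFam_mem 2)
  rw [← h0] at e0
  rw [← h1] at e1
  rw [← h2] at e2
  fin_cases i <;> fin_cases j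
  · simp
  · exact e2
  · simpa using posSpace.neg_mem e1
  · simpa using posSpace.neg_mem e2
  · simp
  · exact e0
  · exact e1
  · simpa using posSpace.neg_mem e0
  · simp

/-- Each product is half the sum of its symmetric part, quadratic in the position, and its
antisymmetric part, linear in it. -/
theorem nullSpace_mul_nullStarSpace_le : nullSpace * nullStarSpace ≤ posSpace ^ 2 := by
  rw [nullSpace, nullStarSpace, Submodule.span_mul_span, Submodule.span_le]
  rintro _ ⟨_, ⟨i, rfl⟩, _, ⟨j, rfl⟩, rfl⟩
  have h1 : nullFam i * star (nullFam j) + nullFam j * star (nullFam i) ∈ posSpace ^ 2 := by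
    rw [nullFam_mul_star_self]
    refine Submodule.sub_mem _ (Submodule.smul_mem _ _ ?_) (Submodule.smul_mem _ _ ?_)
    · rw [sq, ← one_mul (1 : Family)]
      exact Submodule.mul_mem_mul one_mem_posSpace one_mem_posSpace
    · rw [sq]
      exact Submodule.mul_mem_mul (posFam_mem i) (posFam_mem j)
  have h2 : nullFam i * star (nullFam j) - nullFam j * star (nullFam i) ∈ posSpace ^ 2 := by
    have := posSpace_pow_mono (d := 1) (e := 2) (by norm_num)
    rw [pow_one] at this
    exact this (nullFam_mul_star_sub i j)
  have h3 := Submodule.smul_mem _ (1 / 2 : ℂ) (Submodule.add_mem _ h1 h2)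
  rwa [add_add_sub_cancel, ← two_smul ℂ, smul_smul, one_div_mul_cancel two_ne_zero,
    one_smul] at h3

theorem star_mem_pow {M N : Submodule ℂ Family} (h : ∀ F ∈ M, star F ∈ N) (n : ℕ) :
    ∀ F ∈ M ^ n, star F ∈ N ^ n := by
  induction n with
  | zero =>
    intro F hF
    rw [pow_zero, Submodule.mem_one] at hF ⊢
    obtain ⟨c, rfl⟩ := hF
    exact ⟨star c, by rw [algebraMap_star_comm]⟩
  | succ n ih =>
    intro F hF
    rw [pow_succ] at hF ⊢
    induction hF using Submodule.mul_induction_on' with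
    | mem_mul_mem a ha b hb =>
      rw [star_mul']
      exact Submodule.mul_mem_mul (ih a ha) (h b hb)
    | add a ha b hb iha ihb =>
      rw [star_add]
      exact Submodule.add_mem _ iha ihb

theorem star_mem_span {S T : Set Family} (h : ∀ F ∈ S, star F ∈ Submodule.span ℂ T) :
    ∀ F ∈ Submodule.span ℂ S, star F ∈ Submodule.span ℂ T := by
  intro F hF
  induction hF using Submodule.span_induction with
  | mem F hF => exact h F hF
  | zero => simp
  | add a b _ _ ha hb =>
    rw [star_add]
    exact Submodule.add_mem _ ha hb
  | smul c a _ ha =>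
    rw [star_smul]
    exact Submodule.smul_mem _ _ ha

theorem star_mem_posSpace : ∀ F ∈ posSpace, star F ∈ posSpace := by
  refine star_mem_span ?_
  rintro F (rfl | ⟨i, rfl⟩)
  · rw [star_one]
    exact one_mem_posSpace
  · rw [star_posFam]
    exact posFam_mem i

theorem star_mem_mul {M M' N N' : Submodule ℂ Family} (h : ∀ F ∈ M, star F ∈ N)
    (h' : ∀ F ∈ M', star F ∈ N') : ∀ F ∈ M * M', star F ∈ N * N' := by
  intro F hF
  induction hF using Submodule.mul_induction_on' with
  | mem_mul_mem a ha b hb =>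
    rw [star_mul']
    exact Submodule.mul_mem_mul (h a ha) (h' b hb)
  | add a ha b hb iha ihb =>
    rw [star_add]
    exact Submodule.add_mem _ iha ihb

theorem star_mem_nullStar (d n : ℕ) :
    ∀ F ∈ posSpace ^ d * nullSpace ^ n, star F ∈ posSpace ^ d * nullStarSpace ^ n := by
  refine star_mem_mul (star_mem_pow star_mem_posSpace d) (star_mem_pow (star_mem_span ?_) n)
  rintro _ ⟨i, rfl⟩
  exact star_nullFam_mem i

theorem star_mem_null (d n : ℕ) :
    ∀ F ∈ posSpace ^ d * nullStarSpace ^ n, star F ∈ posSpace ^ d * nullSpace ^ n := by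
  refine star_mem_mul (star_mem_pow star_mem_posSpace d) (star_mem_pow (star_mem_span ?_) n)
  rintro _ ⟨i, rfl⟩
  rw [Pi.star_apply, star_star]
  exact nullFam_mem i

/-! ### Raising of polynomial spin functions -/

theorem HasEth.zero (s : ℤ) : HasEth s 0 0 := by
  have h := hasEth_one.smul 0
  rw [zero_smul, zero_smul] at h
  intro R p
  obtain ⟨a, b, ha, hb, hab⟩ := h R p
  exact ⟨a, b, ha, hb, by simpa using hab⟩

theorem hasEth_zero_of_mem_nullSpace {F : Family} (hF : F ∈ nullSpace) : HasEth 1 F 0 := by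
  induction hF using Submodule.span_induction with
  | mem F hF =>
    obtain ⟨i, rfl⟩ := hF
    exact hasEth_nullFam i
  | zero => exact HasEth.zero 1
  | add a b _ _ ha hb => simpa using ha.add hb
  | smul c a _ ha => simpa using ha.smul c

theorem hasEth_zero_of_mem_one {F : Family} (hF : F ∈ (1 : Submodule ℂ Family)) :
    HasEth 0 F 0 := by
  rw [Submodule.mem_one] at hF
  obtain ⟨c, rfl⟩ := hF
  rw [Algebra.algebraMap_eq_smul_one]
  simpa using hasEth_one.smul c

theorem hasEth_zero_of_mem_nullSpace_pow (n : ℕ) :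
    ∀ F ∈ nullSpace ^ n, HasEth n F 0 := by
  induction n with
  | zero =>
    intro F hF
    exact hasEth_zero_of_mem_one hF
  | succ n ih =>
    intro F hF
    rw [pow_succ] at hF
    induction hF using Submodule.mul_induction_on' with
    | mem_mul_mem a ha b hb => simpa using (ih a ha).mul (hasEth_zero_of_mem_nullSpace hb)
    | add a ha b hb iha ihb => simpa using iha.add ihb

/-- For `F = p_i` the last clause is the index exchange `p_i m_j - p_j m_i`; it starts the induction
for the Euler-type relation. -/
theorem exists_hasEth_posSpace {F : Family} (hF : F ∈ posSpace) :
    ∃ G ∈ nullSpace, HasEth 0 F G ∧ ∀ j, G * posFam j + F * nullFam j ∈ nullSpace := by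
  induction hF using Submodule.span_induction with
  | mem F hF =>
    rcases hF with rfl | ⟨i, rfl⟩
    · exact ⟨0, Submodule.zero_mem _, hasEth_one, fun j => by simpa using nullFam_mem j⟩
    · refine ⟨-nullFam i, Submodule.neg_mem _ (nullFam_mem i), hasEth_posFam i, fun j => ?_⟩
      convert posFam_mul_nullFam_sub i j using 1
      ring
  | zero => exact ⟨0, Submodule.zero_mem _, HasEth.zero 0, fun j => by simp⟩
  | add a b _ _ ha hb =>
    obtain ⟨G, hG, h1, h2⟩ := ha
    obtain ⟨G', hG', h1', h2'⟩ := hb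
    refine ⟨G + G', Submodule.add_mem _ hG hG', h1.add h1', fun j => ?_⟩
    convert Submodule.add_mem _ (h2 j) (h2' j) using 1
    ring
  | smul c a _ ha =>
    obtain ⟨G, hG, h1, h2⟩ := ha
    refine ⟨c • G, Submodule.smul_mem _ c hG, h1.smul c, fun j => ?_⟩
    convert Submodule.smul_mem _ c (h2 j) using 1
    rw [smul_add, smul_mul_assoc, smul_mul_assoc]

theorem mul_mul_add_smul_identity {A : Type*} [CommRing A] [Algebra ℂ A] (c : ℂ)
    (a a' b b' p m : A) : a * (b' * p + c • (b * m)) + b * (a' * p + a * m) =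
      (a' * b + a * b') * p + (c + 1) • (a * b * m) := by
  simp only [Algebra.smul_def, map_add, map_one]
  ring

theorem add_mul_add_smul_identity {A : Type*} [CommRing A] [Algebra ℂ A] (c : ℂ)
    (a a' b b' p m : A) : (a' * p + c • (a * m)) + (b' * p + c • (b * m)) =
      (a' + b') * p + c • ((a + b) * m) := by
  simp only [Algebra.smul_def]
  ring

/-- An Euler-type relation: modulo lower degree, `(ð F) p_j` is `-(d+1) F m_j`. Each of the `d + 1`
linear factors contributes one index exchange when the Leibniz rule is applied. -/
theorem exists_hasEth_posSpace_pow (d : ℕ) : ∀ F ∈ posSpace ^ (d + 1),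
    ∃ G ∈ posSpace ^ d * nullSpace, HasEth 0 F G ∧
      ∀ j, G * posFam j + ((d : ℂ) + 1) • (F * nullFam j) ∈ posSpace ^ d * nullSpace := by
  induction d with
  | zero =>
    intro F hF
    rw [zero_add, pow_one] at hF
    simpa using exists_hasEth_posSpace hF
  | succ d ih =>
    intro F hF
    rw [pow_succ'] at hF
    induction hF using Submodule.mul_induction_on' with
    | mem_mul_mem a ha b hb =>
      obtain ⟨a', ha', h1, h2⟩ := exists_hasEth_posSpace ha
      obtain ⟨b', hb', h1', h2'⟩ := ih b hb
      have key : ∀ x ∈ posSpace ^ d * nullSpace, a * x ∈ posSpace ^ (d + 1) * nullSpace := by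
        intro x hx
        rw [pow_succ', mul_assoc]
        exact Submodule.mul_mem_mul ha hx
      have key' : ∀ x ∈ nullSpace, b * x ∈ posSpace ^ (d + 1) * nullSpace := fun x hx =>
        Submodule.mul_mem_mul hb hx
      have h4 := h1.mul h1'
      rw [add_zero] at h4
      refine ⟨a' * b + a * b', ?_, h4, fun j => ?_⟩
      · rw [mul_comm a' b]
        exact Submodule.add_mem _ (key' _ ha') (key _ hb')
      · have h3 := Submodule.add_mem _ (key _ (h2' j)) (key' _ (h2 j))
        rw [mul_mul_add_smul_identity] at h3
        rw [Nat.cast_succ]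
        exact h3
    | add a ha b hb iha ihb =>
      obtain ⟨G, hG, h1, h2⟩ := iha
      obtain ⟨G', hG', h1', h2'⟩ := ihb
      refine ⟨G + G', Submodule.add_mem _ hG hG', h1.add h1', fun j => ?_⟩
      have h3 := Submodule.add_mem _ (h2 j) (h2' j)
      rw [add_mul_add_smul_identity] at h3
      exact h3

theorem exists_hasEth (d n : ℕ) : ∀ F ∈ posSpace ^ (d + 1) * nullSpace ^ n,
    ∃ G ∈ posSpace ^ d * nullSpace ^ (n + 1), HasEth n F G := by
  intro F hF
  induction hF using Submodule.mul_induction_on' with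
  | mem_mul_mem a ha b hb =>
    obtain ⟨a', ha', h1, -⟩ := exists_hasEth_posSpace_pow d a ha
    refine ⟨a' * b, ?_, ?_⟩
    · rw [pow_succ', ← mul_assoc]
      exact Submodule.mul_mem_mul ha' hb
    · simpa using h1.mul (hasEth_zero_of_mem_nullSpace_pow n b hb)
  | add a ha b hb iha ihb =>
    obtain ⟨G, hG, h1⟩ := iha
    obtain ⟨G', hG', h1'⟩ := ihb
    exact ⟨G + G', Submodule.add_mem _ hG hG', h1.add h1'⟩

theorem hasEth_zero_of_mem (n : ℕ) : ∀ F ∈ posSpace ^ 0 * nullSpace ^ n, HasEth n F 0 := by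
  intro F hF
  rw [pow_zero, one_mul] at hF
  exact hasEth_zero_of_mem_nullSpace_pow n F hF

/-- The result of raising the members of a space of spin `n` functions. -/
def raiseImage (n : ℤ) (M : Submodule ℂ Family) : Submodule ℂ Family where
  carrier := {G | ∃ H ∈ M, HasEth n H G}
  add_mem' := by
    rintro _ _ ⟨H, hH, h⟩ ⟨H', hH', h'⟩
    exact ⟨H + H', M.add_mem hH hH', h.add h'⟩
  zero_mem' := ⟨0, M.zero_mem, HasEth.zero n⟩
  smul_mem' := by
    rintro c _ ⟨H, hH, h⟩
    exact ⟨c • H, M.smul_mem c hH, h.smul c⟩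

theorem raiseImage_mono (n : ℤ) {M N : Submodule ℂ Family} (h : M ≤ N) :
    raiseImage n M ≤ raiseImage n N := fun _ ⟨H, hH, hG⟩ => ⟨H, h hH, hG⟩

/-- Reduction by linearity to a single generator `m_j` in one of the null factors. -/
theorem mul_nullSpace_pow_succ_le (n : ℕ) (S T : Submodule ℂ Family)
    (h : ∀ f ∈ S, ∀ j, ∀ g ∈ nullSpace ^ n, f * nullFam j * g ∈ T) :
    S * nullSpace ^ (n + 1) ≤ T := by
  rw [pow_succ', ← mul_assoc, Submodule.mul_le]
  intro x hx g hg
  revert x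
  change S * nullSpace ≤ T.comap (LinearMap.mulRight ℂ g)
  rw [Submodule.mul_le]
  intro f hf k hk
  revert k
  change nullSpace ≤ (T.comap (LinearMap.mulRight ℂ g)).comap (LinearMap.mulLeft ℂ f)
  rw [nullSpace, Submodule.span_le]
  rintro _ ⟨j, rfl⟩
  exact h f hf j g hg

theorem leading_term_identity {A : Type*} [CommRing A] [Algebra ℂ A] (c : ℂ)
    (f f' p m g : A) : (f' * p + (c + 1) • (f * m)) * g - (f' * p + f * -m) * g =
      (c + 2) • (f * m * g) := by
  simp only [Algebra.smul_def, map_add, map_one]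
  rw [← one_add_one_eq_two, map_add, map_one]
  ring

/-- Every polynomial spin `n + 1` function is the result of raising a polynomial spin `n`
function of one degree more. -/
theorem nullSpace_pow_succ_le_raiseImage (n d : ℕ) : posSpace ^ d * nullSpace ^ (n + 1) ≤
    raiseImage n (posSpace ^ (d + 1) * nullSpace ^ n) := by
  induction d with
  | zero =>
    refine mul_nullSpace_pow_succ_le n _ _ fun f hf j g hg => ?_
    -- For constant `f` one has `ð(f p_j g) = -f m_j g`.
    rw [pow_zero] at hf
    have h := ((hasEth_zero_of_mem_one hf).mul (hasEth_posFam j)).mul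
      (hasEth_zero_of_mem_nullSpace_pow n g hg)
    rw [zero_mul, zero_add, mul_zero, add_zero, mul_neg, zero_add, zero_add, neg_mul] at h
    rw [← neg_mem_iff]
    refine ⟨f * posFam j * g, Submodule.mul_mem_mul ?_ hg, h⟩
    rw [pow_succ, pow_zero]
    exact Submodule.mul_mem_mul hf (posFam_mem j)
  | succ d ih =>
    refine mul_nullSpace_pow_succ_le n _ _ fun f hf j g hg => ?_
    obtain ⟨f', hf', h1, h2⟩ := exists_hasEth_posSpace_pow d f hf
    -- By the Euler-type relation this element has position degree only `d`, so the induction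
    -- hypothesis applies.
    have hlow : (f' * posFam j + ((d : ℂ) + 1) • (f * nullFam j)) * g ∈
        raiseImage n (posSpace ^ (d + 1 + 1) * nullSpace ^ n) := by
      refine raiseImage_mono n (mul_le_mul_left (posSpace_pow_mono (Nat.le_succ _)) _) (ih ?_)
      rw [pow_succ', ← mul_assoc]
      exact Submodule.mul_mem_mul (h2 j) hg
    -- This element is `ð(f p_j g)`, since `ð g = 0`.
    have htop : (f' * posFam j + f * -nullFam j) * g ∈
        raiseImage n (posSpace ^ (d + 1 + 1) * nullSpace ^ n) := by
      have h := (h1.mul (hasEth_posFam j)).mul (hasEth_zero_of_mem_nullSpace_pow n g hg)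
      rw [mul_zero, zero_add, zero_add, add_zero] at h
      refine ⟨f * posFam j * g, Submodule.mul_mem_mul ?_ hg, h⟩
      rw [pow_succ]
      exact Submodule.mul_mem_mul hf (posFam_mem j)
    -- The terms `f' p_j g` cancel, leaving `(d + 2) f m_j g` with a nonzero factor.
    have h3 := Submodule.sub_mem _ hlow htop
    rw [leading_term_identity] at h3
    have h4 := Submodule.smul_mem _ ((d : ℂ) + 2)⁻¹ h3
    have hne : (d : ℂ) + 2 ≠ 0 := by exact_mod_cast (by omega : d + 2 ≠ 0)
    rwa [smul_smul, inv_mul_cancel₀ hne, one_smul] at h4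

/-! ### Iterated raising -/

theorem eth_add {d n : ℕ} {F G : Family} (hF : F ∈ posSpace ^ d * nullSpace ^ n)
    (hG : G ∈ posSpace ^ d * nullSpace ^ n) : eth n (F + G) = eth n F + eth n G := by
  have key : ∀ H ∈ posSpace ^ d * nullSpace ^ n, ∃ H', HasEth n H H' := fun H hH => by
    cases d with
    -- With no position factor left, raising gives zero; `exists_hasEth` covers only positive
    -- degree.
    | zero => exact ⟨0, hasEth_zero_of_mem n H hH⟩
    | succ d => exact (exists_hasEth d n H hH).imp fun _ h => h.2
  obtain ⟨F', hF'⟩ := key F hF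
  obtain ⟨G', hG'⟩ := key G hG
  rw [hF'.eth_eq, hG'.eth_eq, (hF'.add hG').eth_eq]

theorem eth_smul (s : ℤ) (c : ℂ) (F : Family) : eth s (c • F) = c • eth s F := by
  ext R p
  simp only [eth, Pi.smul_apply, inCoords_smul, mul_left_comm _ c, deriv_const_mul_field,
    smul_eq_mul]
  ring

theorem eth_mem {d n : ℕ} {F : Family} (hF : F ∈ posSpace ^ (d + 1) * nullSpace ^ n) :
    eth n F ∈ posSpace ^ d * nullSpace ^ (n + 1) := by
  obtain ⟨G, hG, h⟩ := exists_hasEth d n F hF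
  rwa [h.eth_eq]

theorem ethPow_mem (n : ℕ) : ∀ d : ℕ, ∀ F ∈ posSpace ^ (d + n),
    ethPow n F ∈ posSpace ^ d * nullSpace ^ n := by
  induction n with
  | zero =>
    intro d F hF
    rwa [pow_zero, mul_one]
  | succ n ih =>
    intro d F hF
    exact eth_mem (ih (d + 1) F (by rwa [add_right_comm]))

/-- After `d` raisings only null factors remain, and the next raising kills them. This disposes of
the harmonics with `l < n`, which have no spin `n` counterpart. -/
theorem ethPow_eq_zero (n : ℕ) : ∀ d < n, ∀ F ∈ posSpace ^ d, ethPow n F = 0 := by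
  induction n with
  | zero =>
    intro d hd
    omega
  | succ n ih =>
    intro d hd F hF
    rw [ethPow]
    rcases Nat.lt_succ_iff_lt_or_eq.1 hd with h | rfl
    · rw [ih d h F hF]
      exact (HasEth.zero n).eth_eq
    · refine (hasEth_zero_of_mem d _ (ethPow_mem d 0 F ?_)).eth_eq
      rwa [zero_add]

theorem ethPow_add (n d : ℕ) {F G : Family} (hF : F ∈ posSpace ^ (d + n))
    (hG : G ∈ posSpace ^ (d + n)) : ethPow n (F + G) = ethPow n F + ethPow n G := by
  induction n generalizing d with
  | zero => rfl
  | succ n ih =>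
    have e : d + (n + 1) = d + 1 + n := by ring
    rw [e] at hF hG
    rw [ethPow, ethPow, ethPow, ih (d + 1) hF hG,
      eth_add (ethPow_mem n (d + 1) F hF) (ethPow_mem n (d + 1) G hG)]

theorem ethPow_smul (n : ℕ) (c : ℂ) (F : Family) : ethPow n (c • F) = c • ethPow n F := by
  induction n with
  | zero => rfl
  | succ n ih => rw [ethPow, ethPow, ih, eth_smul]

/-- Lowering is conjugate to raising. -/
theorem negEthBarPow_eq (n : ℕ) (F : Family) :
    negEthBarPow n F = (-1 : ℂ) ^ n • star (ethPow n (star F)) := by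
  have hstar : ∀ k : ℕ, star ((-1 : ℂ) ^ k) = (-1) ^ k := fun k => by simp
  induction n with
  | zero => simp [negEthBarPow, ethPow]
  | succ n ih =>
    rw [negEthBarPow, ethPow, ih, ← hstar n, ← star_smul, ethBar_star, eth_smul, star_smul,
      hstar, pow_succ, mul_neg_one, neg_smul]

theorem exists_ethPow_eq (n : ℕ) : ∀ d : ℕ, ∀ F ∈ posSpace ^ d * nullSpace ^ n,
    ∃ H ∈ posSpace ^ (d + n), ethPow n H = F := by
  induction n with
  | zero =>
    intro d F hF
    exact ⟨F, by rwa [pow_zero, mul_one] at hF, rfl⟩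
  | succ n ih =>
    intro d F hF
    obtain ⟨H, hH, h⟩ := nullSpace_pow_succ_le_raiseImage n d hF
    obtain ⟨H', hH', h'⟩ := ih (d + 1) H hH
    refine ⟨H', by rwa [add_right_comm] at hH', ?_⟩
    rw [ethPow, h', h.eth_eq]

/-! ### Spherical harmonics as polynomials -/

/-- Exactness of the degree `l - m` is what makes the elimination in `mul_polyFam_mem` triangular.
-/
theorem coeff_iterate_derivative_legendre_ne_zero {l m : ℕ} (h : m ≤ l) :
    (Polynomial.derivative^[m] (legendre l)).coeff (l - m) ≠ 0 := by
  have hmonic : ((Polynomial.X ^ 2 - 1 : Polynomial ℝ) ^ l).coeff (l + l) = 1 := by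
    have h1 : (Polynomial.X ^ 2 - 1 : Polynomial ℝ).Monic := by
      simpa using Polynomial.monic_X_pow_sub_C (1 : ℝ) two_ne_zero
    have h2 : (Polynomial.X ^ 2 - 1 : Polynomial ℝ).natDegree = 2 := by
      simpa using Polynomial.natDegree_X_pow_sub_C (n := 2) (r := (1 : ℝ))
    have h3 := (h1.pow l).coeff_natDegree
    rwa [h1.natDegree_pow, h2, mul_two] at h3
  rw [Polynomial.coeff_iterate_derivative, Nat.sub_add_cancel h, legendre,
    Polynomial.coeff_C_mul, Polynomial.coeff_iterate_derivative, hmonic]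
  have h1 : (l.descFactorial m : ℝ) ≠ 0 := by
    exact_mod_cast (Nat.descFactorial_pos.2 h).ne'
  have h2 : ((l + l).descFactorial l : ℝ) ≠ 0 := by
    exact_mod_cast (Nat.descFactorial_pos.2 (Nat.le_add_left l l)).ne'
  have h3 : (l.factorial : ℝ) ≠ 0 := by exact_mod_cast l.factorial_ne_zero
  simp only [nsmul_eq_mul, mul_one]
  positivity

theorem natDegree_legendre_le (l : ℕ) : (legendre l).natDegree ≤ l := by
  have h1 : ((Polynomial.X ^ 2 - 1 : Polynomial ℝ) ^ l).natDegree ≤ l * 2 := by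
    refine Polynomial.natDegree_pow_le_of_le l ?_
    simpa using (Polynomial.natDegree_X_pow_sub_C (n := 2) (r := (1 : ℝ))).le
  refine (Polynomial.natDegree_C_mul_le _ _).trans
    ((Polynomial.natDegree_iterate_derivative _ _).trans ?_)
  omega

theorem natDegree_iterate_derivative_legendre_le (l m : ℕ) :
    (Polynomial.derivative^[m] (legendre l)).natDegree ≤ l - m :=
  (Polynomial.natDegree_iterate_derivative _ _).trans
    (Nat.sub_le_sub_right (natDegree_legendre_le l) m)

/-- A polynomial in the third coordinate. -/
def polyFam (q : Polynomial ℝ) : Family := fun _ p => ((q.eval (vec p.1 2) : ℝ) : ℂ)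

theorem polyFam_monomial (k : ℕ) (c : ℝ) :
    polyFam (Polynomial.C c * Polynomial.X ^ k) = (c : ℂ) • posFam 2 ^ k := by
  ext R p
  simp [polyFam, posFam]

theorem polyFam_sub_C_mul (q q' : Polynomial ℝ) (c : ℝ) :
    polyFam (q - Polynomial.C c * q') = polyFam q - (c : ℂ) • polyFam q' := by
  ext R p
  simp [polyFam]

theorem star_polyFam (q : Polynomial ℝ) : star (polyFam q) = polyFam q := by
  ext R p
  simp [polyFam]

theorem polyFam_mem {d : ℕ} {q : Polynomial ℝ} (h : q.natDegree ≤ d) :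
    polyFam q ∈ posSpace ^ d := by
  have hsum : polyFam q = ∑ i ∈ Finset.range (q.natDegree + 1), (q.coeff i : ℂ) • posFam 2 ^ i := by
    ext R p
    simp only [polyFam, Finset.sum_apply, Pi.smul_apply, Pi.pow_apply, posFam, smul_eq_mul]
    rw [Polynomial.eval_eq_sum_range]
    push_cast
    rfl
  rw [hsum]
  refine Submodule.sum_mem _ fun i hi => Submodule.smul_mem _ _ ?_
  refine posSpace_pow_mono (d := i) ?_ (Submodule.pow_mem_pow _ (posFam_mem 2) i)
  rw [Finset.mem_range] at hi
  omega

/-- The coordinate `x + iy`. -/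
def plusFam : Family := posFam 0 + Complex.I • posFam 1

theorem plusFam_mem : plusFam ∈ posSpace :=
  Submodule.add_mem _ (posFam_mem 0) (Submodule.smul_mem _ _ (posFam_mem 1))

theorem star_plusFam : star plusFam = posFam 0 - Complex.I • posFam 1 := by
  rw [plusFam, star_add, star_smul, star_posFam, star_posFam, sub_eq_add_neg, ← neg_smul]
  simp

theorem plusFam_mul_star : plusFam * star plusFam = 1 - posFam 2 ^ 2 := by
  rw [star_plusFam, plusFam, ← posFam_sum_sq]
  ext R p
  simp only [Pi.mul_apply, Pi.add_apply, Pi.sub_apply, Pi.smul_apply, Pi.pow_apply, smul_eq_mul]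
  linear_combination -(posFam 1 R p) ^ 2 * Complex.I_sq

theorem ofFun_sphHarmonicNonneg (l m : ℕ) : ∃ c : ℂ, c ≠ 0 ∧
    ofFun (sphHarmonicNonneg l m) =
      c • (plusFam ^ m * polyFam (Polynomial.derivative^[m] (legendre l))) := by
  refine ⟨(-1) ^ m * (Real.sqrt ((2 * l + 1) / (4 * Real.pi) *
      (((l - m).factorial : ℝ) / ((l + m).factorial : ℝ))) : ℂ), ?_, ?_⟩
  · refine mul_ne_zero (by simp) ?_
    have h1 := (l - m).factorial_pos
    have h2 := (l + m).factorial_pos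
    rw [Complex.ofReal_ne_zero]
    positivity
  · ext R p
    have h : (⟨vec p.1 0, vec p.1 1⟩ : ℂ) = (vec p.1 0 : ℂ) + Complex.I * (vec p.1 1 : ℂ) := by
      apply Complex.ext <;> simp
    simp only [ofFun, sphHarmonicNonneg, plusFam, posFam, polyFam, Pi.smul_apply, Pi.mul_apply,
      Pi.pow_apply, Pi.add_apply, smul_eq_mul, h]
    ring

theorem ofFun_sphHarmonic_natCast (l m : ℕ) :
    ofFun (sphHarmonic l m) = ofFun (sphHarmonicNonneg l m) := by
  ext R p
  simp [ofFun, sphHarmonic]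

theorem ofFun_sphHarmonic_neg (l : ℕ) {m : ℕ} (hm : 0 < m) :
    ofFun (sphHarmonic l (-m)) = ((-1 : ℂ) ^ m) • star (ofFun (sphHarmonicNonneg l m)) := by
  ext R p
  have h : ¬ (0 : ℤ) ≤ -m := by omega
  simp [ofFun, sphHarmonic, hm.ne']

theorem ofFun_sphHarmonicNonneg_mem {l m : ℕ} (h : m ≤ l) :
    ofFun (sphHarmonicNonneg l m) ∈ posSpace ^ l := by
  obtain ⟨c, -, hc⟩ := ofFun_sphHarmonicNonneg l m
  rw [hc, ← Nat.add_sub_cancel' h, pow_add]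
  refine Submodule.smul_mem _ _ (Submodule.mul_mem_mul (Submodule.pow_mem_pow _ plusFam_mem m) ?_)
  rw [Nat.add_sub_cancel' h]
  exact polyFam_mem (natDegree_iterate_derivative_legendre_le l m)

theorem ofFun_sphHarmonic_mem {l : ℕ} {m : ℤ} (h1 : -(l : ℤ) ≤ m) (h2 : m ≤ l) :
    ofFun (sphHarmonic l m) ∈ posSpace ^ l := by
  rcases le_or_gt 0 m with hm | hm
  · lift m to ℕ using hm
    rw [ofFun_sphHarmonic_natCast]
    exact ofFun_sphHarmonicNonneg_mem (by omega)
  · obtain ⟨n, rfl⟩ : ∃ n : ℕ, m = -n := ⟨m.natAbs, by omega⟩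
    rw [ofFun_sphHarmonic_neg l (by omega)]
    exact Submodule.smul_mem _ _ (star_mem_pow star_mem_posSpace l _
      (ofFun_sphHarmonicNonneg_mem (by omega)))

/-! ### Completeness of the spherical harmonics -/

/-- The span of the spherical harmonics of degree at most `L`. -/
def harmonicSpan (L : ℕ) : Submodule ℂ Family :=
  Submodule.span ℂ {F | ∃ (l : ℕ) (m : ℤ), l ≤ L ∧ -(l : ℤ) ≤ m ∧ m ≤ l ∧
    F = ofFun (sphHarmonic l m)}

/-- For fixed `m`, the `m`-th derivatives of the Legendre polynomials have degrees 0, 1, 2, ..., so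
the leading term of `q` can be removed step by step. -/
theorem mul_polyFam_mem (S : Submodule ℂ Family) (U : Family) (L m : ℕ)
    (h : ∀ l, m ≤ l → l ≤ L →
      U * polyFam (Polynomial.derivative^[m] (legendre l)) ∈ S) :
    ∀ (d : ℕ) (q : Polynomial ℝ), q.natDegree < d → m + d ≤ L + 1 → U * polyFam q ∈ S := by
  intro d
  induction d with
  | zero => intro q hq; omega
  | succ d ih =>
    intro q hq hd
    set e := Polynomial.derivative^[m] (legendre (m + d)) with he
    have hlead : e.coeff d ≠ 0 := by
      have := coeff_iterate_derivative_legendre_ne_zero (Nat.le_add_right m d)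
      rwa [Nat.add_sub_cancel_left] at this
    have hdeg : e.natDegree ≤ d := by
      have := natDegree_iterate_derivative_legendre_le (m + d) m
      rwa [Nat.add_sub_cancel_left] at this
    set c := q.coeff d / e.coeff d with hc
    have hrest : U * polyFam (q - Polynomial.C c * e) ∈ S := by
      have hcoeff : (q - Polynomial.C c * e).coeff d = 0 := by
        rw [Polynomial.coeff_sub, Polynomial.coeff_C_mul, hc, div_mul_cancel₀ _ hlead, sub_self]
      have hle : (q - Polynomial.C c * e).natDegree ≤ d :=
        (Polynomial.natDegree_sub_le _ _).trans (max_le (Nat.lt_succ_iff.1 hq)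
          ((Polynomial.natDegree_C_mul_le _ _).trans hdeg))
      -- In degree zero `natDegree` cannot drop further, so the remainder is shown to vanish
      -- instead.
      rcases Nat.eq_zero_or_pos d with rfl | hpos
      · have : q - Polynomial.C c * e = 0 := by
          rw [Polynomial.eq_C_of_natDegree_le_zero hle, hcoeff, Polynomial.C_0]
        rw [this]
        convert S.zero_mem
        ext R p
        simp [polyFam]
      · refine ih _ (lt_of_le_of_ne hle fun heq => ?_) (by omega)
        have h0 : (q - Polynomial.C c * e).leadingCoeff = 0 := by
          rw [Polynomial.leadingCoeff, heq, hcoeff]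
        rw [Polynomial.leadingCoeff_eq_zero.1 h0, Polynomial.natDegree_zero] at heq
        omega
    rw [polyFam_sub_C_mul, mul_sub, mul_smul_comm] at hrest
    have h2 := S.add_mem hrest (S.smul_mem (c : ℂ) (h (m + d) (Nat.le_add_right m d) (by omega)))
    rwa [sub_add_cancel] at h2

theorem posFam_two_pow (k : ℕ) : posFam 2 ^ k = polyFam (Polynomial.X ^ k) := by
  have := polyFam_monomial k 1
  simpa using this.symm

theorem plusFam_pow_mul_mem {L m k : ℕ} (h : m + k ≤ L) :
    plusFam ^ m * posFam 2 ^ k ∈ harmonicSpan L := by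
  rw [posFam_two_pow]
  refine mul_polyFam_mem _ _ L m (fun l hml hl => ?_) (k + 1) _ (by simp) (by omega)
  obtain ⟨c, hc0, hc⟩ := ofFun_sphHarmonicNonneg l m
  have hmem : ofFun (sphHarmonic l m) ∈ harmonicSpan L :=
    Submodule.subset_span ⟨l, m, hl, by omega, by omega, rfl⟩
  rw [ofFun_sphHarmonic_natCast, hc] at hmem
  exact (Submodule.smul_mem_iff _ hc0).1 hmem

theorem star_plusFam_pow_mul_mem {L m k : ℕ} (h : m + k ≤ L) :
    star plusFam ^ m * posFam 2 ^ k ∈ harmonicSpan L := by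
  rcases Nat.eq_zero_or_pos m with rfl | hm
  · simpa using plusFam_pow_mul_mem h
  rw [posFam_two_pow]
  refine mul_polyFam_mem _ _ L m (fun l hml hl => ?_) (k + 1) _ (by simp) (by omega)
  obtain ⟨c, hc0, hc⟩ := ofFun_sphHarmonicNonneg l m
  have hmem : ofFun (sphHarmonic l (-m)) ∈ harmonicSpan L :=
    Submodule.subset_span ⟨l, -m, hl, by omega, by omega, rfl⟩
  rw [ofFun_sphHarmonic_neg l hm, hc, star_smul, star_mul', star_pow, star_polyFam] at hmem
  rw [Submodule.smul_mem_iff _ (by simp), Submodule.smul_mem_iff _ (by simpa using hc0)] at hmem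
  exact hmem

/-- The span of `U ^ m * Z ^ k` and `V ^ m * Z ^ k`, `m + k ≤ L`. -/
def twoSidedSpan (U V Z : Family) (L : ℕ) : Submodule ℂ Family :=
  Submodule.span ℂ {F | ∃ m k : ℕ, m + k ≤ L ∧ (F = U ^ m * Z ^ k ∨ F = V ^ m * Z ^ k)}

theorem twoSidedSpan_comm (U V Z : Family) (L : ℕ) :
    twoSidedSpan U V Z L = twoSidedSpan V U Z L := by
  simp only [twoSidedSpan, or_comm]

/-- A mixed product `U V` is replaced by `1 - Z ^ 2`, which does not raise the degree, so only pure
powers of `U` or of `V` survive. -/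
theorem mul_twoSidedSpan_le {U V Z : Family} (h : U * V = 1 - Z ^ 2) (L : ℕ) :
    ∀ F ∈ twoSidedSpan U V Z L, U * F ∈ twoSidedSpan U V Z (L + 1) := by
  intro F hF
  revert F
  change twoSidedSpan U V Z L ≤ (twoSidedSpan U V Z (L + 1)).comap (LinearMap.mulLeft ℂ U)
  rw [twoSidedSpan, Submodule.span_le]
  rintro _ ⟨m, k, hmk, rfl | rfl⟩
  · refine Submodule.subset_span ⟨m + 1, k, by omega, Or.inl ?_⟩
    rw [LinearMap.mulLeft_apply, pow_succ', mul_assoc]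
  · rcases m with _ | m
    · refine Submodule.subset_span ⟨1, k, by omega, Or.inl ?_⟩
      rw [LinearMap.mulLeft_apply, pow_zero, one_mul, pow_one]
    · change U * (V ^ (m + 1) * Z ^ k) ∈ twoSidedSpan U V Z (L + 1)
      have e : U * (V ^ (m + 1) * Z ^ k) = V ^ m * Z ^ k - V ^ m * Z ^ (k + 2) := by
        calc U * (V ^ (m + 1) * Z ^ k) = (U * V) * (V ^ m * Z ^ k) := by ring
          _ = _ := by rw [h]; ring
      rw [e]
      exact Submodule.sub_mem _ (Submodule.subset_span ⟨m, k, by omega, Or.inr rfl⟩)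
        (Submodule.subset_span ⟨m, k + 2, by omega, Or.inr rfl⟩)

theorem mul_twoSidedSpan_le_third (U V Z : Family) (L : ℕ) :
    ∀ F ∈ twoSidedSpan U V Z L, Z * F ∈ twoSidedSpan U V Z (L + 1) := by
  change twoSidedSpan U V Z L ≤ (twoSidedSpan U V Z (L + 1)).comap (LinearMap.mulLeft ℂ Z)
  rw [twoSidedSpan, Submodule.span_le]
  rintro _ ⟨m, k, hmk, h⟩
  refine Submodule.subset_span ⟨m, k + 1, by omega, ?_⟩
  refine h.imp ?_ ?_ <;> rintro rfl <;> rw [LinearMap.mulLeft_apply] <;> ring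

theorem posSpace_pow_le_twoSidedSpan (L : ℕ) :
    posSpace ^ L ≤ twoSidedSpan plusFam (star plusFam) (posFam 2) L := by
  induction L with
  | zero =>
    rw [pow_zero, Submodule.one_le]
    exact Submodule.subset_span ⟨0, 0, le_rfl, Or.inl (by simp)⟩
  | succ L ih =>
    rw [pow_succ', Submodule.mul_le]
    intro f hf g hg
    have hg := ih hg
    have hp := mul_twoSidedSpan_le plusFam_mul_star L g hg
    have hm : star plusFam * g ∈ twoSidedSpan plusFam (star plusFam) (posFam 2) (L + 1) := by
      -- The conjugate case follows by exchanging the roles of `U` and `V`.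
      rw [twoSidedSpan_comm] at hg ⊢
      exact mul_twoSidedSpan_le (by rw [mul_comm, plusFam_mul_star]) L g hg
    have hz := mul_twoSidedSpan_le_third plusFam (star plusFam) (posFam 2) L g hg
    have h1 : 1 * g ∈ twoSidedSpan plusFam (star plusFam) (posFam 2) (L + 1) := by
      rw [one_mul]
      refine Submodule.span_mono ?_ hg
      rintro _ ⟨m, k, hmk, h⟩
      exact ⟨m, k, by omega, h⟩
    revert f
    change posSpace ≤ (twoSidedSpan _ _ _ (L + 1)).comap (LinearMap.mulRight ℂ g)
    rw [posSpace, Submodule.span_le]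
    have e0 : posFam 0 = (1 / 2 : ℂ) • (plusFam + star plusFam) := by
      rw [star_plusFam, plusFam]
      module
    have e1 : posFam 1 = (-Complex.I / 2 : ℂ) • (plusFam - star plusFam) := by
      rw [star_plusFam, plusFam]
      ext R p
      simp only [Pi.add_apply, Pi.sub_apply, Pi.smul_apply, smul_eq_mul]
      linear_combination (posFam 1 R p) * Complex.I_sq
    rintro _ (rfl | ⟨i, rfl⟩)
    · exact h1
    · change posFam i * g ∈ twoSidedSpan _ _ _ (L + 1)
      fin_cases i
      · change posFam 0 * g ∈ twoSidedSpan _ _ _ (L + 1)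
        rw [e0, smul_mul_assoc, add_mul]
        exact Submodule.smul_mem _ _ (Submodule.add_mem _ hp hm)
      · change posFam 1 * g ∈ twoSidedSpan _ _ _ (L + 1)
        rw [e1, smul_mul_assoc, sub_mul]
        exact Submodule.smul_mem _ _ (Submodule.sub_mem _ hp hm)
      · exact hz

theorem posSpace_pow_le_harmonicSpan (L : ℕ) : posSpace ^ L ≤ harmonicSpan L := by
  refine (posSpace_pow_le_twoSidedSpan L).trans ?_
  rw [twoSidedSpan, Submodule.span_le]
  rintro _ ⟨m, k, hmk, rfl | rfl⟩
  · exact plusFam_pow_mul_mem hmk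
  · exact star_plusFam_pow_mul_mem hmk

/-! ### Band-limited spin functions are the polynomial ones -/

theorem mem_of_mem_posSpace_pow {L : ℕ} (T : Family → Family) (W : Submodule ℂ Family)
    (hadd : ∀ F ∈ posSpace ^ L, ∀ G ∈ posSpace ^ L, T (F + G) = T F + T G)
    (hsmul : ∀ (c : ℂ) (F : Family), T (c • F) = c • T F)
    (hY : ∀ (l : ℕ) (m : ℤ), l ≤ L → -(l : ℤ) ≤ m → m ≤ l → T (ofFun (sphHarmonic l m)) ∈ W) :
    ∀ H ∈ posSpace ^ L, T H ∈ W := by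
  intro H hH
  -- Membership in `posSpace ^ L` is carried through the induction because `T` is additive only
  -- there.
  have key : H ∈ posSpace ^ L ∧ T H ∈ W := by
    have hspan := posSpace_pow_le_harmonicSpan L hH
    rw [harmonicSpan] at hspan
    clear hH
    induction hspan using Submodule.span_induction with
    | mem F hF =>
      obtain ⟨l, m, hl, h1, h2, rfl⟩ := hF
      exact ⟨posSpace_pow_mono hl (ofFun_sphHarmonic_mem h1 h2), hY l m hl h1 h2⟩
    | zero =>
      refine ⟨Submodule.zero_mem _, ?_⟩
      have := hsmul 0 0
      rw [zero_smul, zero_smul] at this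
      rw [this]
      exact W.zero_mem
    | add a b _ _ ha hb =>
      refine ⟨Submodule.add_mem _ ha.1 hb.1, ?_⟩
      rw [hadd a ha.1 b hb.1]
      exact W.add_mem ha.2 hb.2
    | smul c a _ ha =>
      refine ⟨Submodule.smul_mem _ c ha.1, ?_⟩
      rw [hsmul]
      exact W.smul_mem c ha.2
  exact key.2

theorem sqrt_factorial_ratio_ne_zero (l n : ℕ) :
    (Real.sqrt (((l - n).factorial : ℝ) / ((l + n).factorial : ℝ)) : ℂ) ≠ 0 := by
  have h1 := (l - n).factorial_pos
  have h2 := (l + n).factorial_pos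
  rw [Complex.ofReal_ne_zero]
  positivity

theorem exists_spinHarmonic_natCast (l n : ℕ) (m : ℤ) : ∃ c : ℂ, c ≠ 0 ∧
    spinHarmonic l m n = c • ethPow n (ofFun (sphHarmonic l m)) :=
  ⟨_, sqrt_factorial_ratio_ne_zero l n, by simp [spinHarmonic]⟩

theorem exists_spinHarmonic_neg (l n : ℕ) (m : ℤ) : ∃ c : ℂ, c ≠ 0 ∧
    spinHarmonic l m (-n) = c • star (ethPow n (star (ofFun (sphHarmonic l m)))) := by
  refine ⟨Real.sqrt (((l - n).factorial : ℝ) / ((l + n).factorial : ℝ)) * (-1) ^ n,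
    mul_ne_zero (sqrt_factorial_ratio_ne_zero l n) (by simp), ?_⟩
  -- Spin `-0` falls into the raising branch of the definition.
  rcases Nat.eq_zero_or_pos n with rfl | hn
  · simp [spinHarmonic, ethPow]
  · have h : ¬ (0 : ℤ) ≤ -n := by omega
    rw [spinHarmonic, if_neg h, Int.natAbs_neg, Int.natAbs_natCast, negEthBarPow_eq, smul_smul]

theorem spinHarmonic_mem_bandLimited {l L : ℕ} {m s : ℤ} (hs : s.natAbs ≤ l) (hl : l ≤ L)
    (h1 : -(l : ℤ) ≤ m) (h2 : m ≤ l) : spinHarmonic l m s ∈ bandLimited L s := by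
  refine Submodule.mem_iSup_of_mem l (Submodule.mem_iSup_of_mem (Finset.mem_Icc.2 ⟨hs, hl⟩) ?_)
  exact Submodule.subset_span ⟨m, h1, h2, rfl⟩

theorem bandLimited_le {L : ℕ} {s : ℤ} {W : Submodule ℂ Family}
    (h : ∀ (l : ℕ) (m : ℤ), s.natAbs ≤ l → l ≤ L → -(l : ℤ) ≤ m → m ≤ l →
      spinHarmonic l m s ∈ W) : bandLimited L s ≤ W := by
  refine iSup₂_le fun l hl => ?_
  rw [Finset.mem_Icc] at hl
  rw [harmonicSpace, Submodule.span_le]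
  rintro _ ⟨m, h1, h2, rfl⟩
  exact h l m hl.1 hl.2 h1 h2

theorem bandLimited_natCast_le (L n : ℕ) :
    bandLimited L n ≤ posSpace ^ (L - n) * nullSpace ^ n := by
  refine bandLimited_le fun l m hn hl h1 h2 => ?_
  rw [Int.natAbs_natCast] at hn
  obtain ⟨c, -, hc⟩ := exists_spinHarmonic_natCast l n m
  rw [hc]
  refine Submodule.smul_mem _ _ (mul_le_mul_left (posSpace_pow_mono (Nat.sub_le_sub_right hl n)) _
    (ethPow_mem n (l - n) _ ?_))
  rw [Nat.sub_add_cancel hn]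
  exact ofFun_sphHarmonic_mem h1 h2

theorem bandLimited_neg_le (L n : ℕ) :
    bandLimited L (-n) ≤ posSpace ^ (L - n) * nullStarSpace ^ n := by
  refine bandLimited_le fun l m hn hl h1 h2 => ?_
  rw [Int.natAbs_neg, Int.natAbs_natCast] at hn
  obtain ⟨c, -, hc⟩ := exists_spinHarmonic_neg l n m
  rw [hc]
  refine Submodule.smul_mem _ _ (mul_le_mul_left (posSpace_pow_mono (Nat.sub_le_sub_right hl n)) _
    (star_mem_nullStar _ _ _ (ethPow_mem n (l - n) _ ?_)))
  rw [Nat.sub_add_cancel hn]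
  exact star_mem_pow star_mem_posSpace l _ (ofFun_sphHarmonic_mem h1 h2)

/-- A member is `ð^n` of a polynomial of degree at most `d + n`; expanding that polynomial in
spherical harmonics leaves multiples of spin harmonics for `l ≥ n` and zero for `l < n`. -/
theorem le_bandLimited_natCast {d n L : ℕ} (h : d + n ≤ L) :
    posSpace ^ d * nullSpace ^ n ≤ bandLimited L n := by
  intro F hF
  obtain ⟨H, hH, rfl⟩ := exists_ethPow_eq n d F hF
  refine mem_of_mem_posSpace_pow (ethPow n) _ (fun F hF G hG => ethPow_add n d hF hG)
    (ethPow_smul n) (fun l m hl h1 h2 => ?_) H hH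
  rcases lt_or_ge l n with hln | hln
  · rw [ethPow_eq_zero n l hln _ (ofFun_sphHarmonic_mem h1 h2)]
    exact Submodule.zero_mem _
  · obtain ⟨c, hc0, hc⟩ := exists_spinHarmonic_natCast l n m
    rw [← Submodule.smul_mem_iff _ hc0, ← hc]
    exact spinHarmonic_mem_bandLimited (by simpa using hln) (hl.trans h) h1 h2

/-- The positive case transported by the map `F ↦ star (ð^n (star F))`, which is linear on
polynomials and is lowering up to sign. -/
theorem le_bandLimited_neg {d n L : ℕ} (h : d + n ≤ L) :
    posSpace ^ d * nullStarSpace ^ n ≤ bandLimited L (-n) := by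
  intro F hF
  obtain ⟨H, hH, hHF⟩ := exists_ethPow_eq n d _ (star_mem_null d n F hF)
  have hstar : ∀ l, ∀ F ∈ posSpace ^ l, star F ∈ posSpace ^ l :=
    star_mem_pow star_mem_posSpace
  have key := mem_of_mem_posSpace_pow (L := d + n) (fun F => star (ethPow n (star F)))
    (bandLimited L (-n)) (fun F hF G hG => ?_) (fun c F => ?_) (fun l m hl h1 h2 => ?_)
    (star H) (hstar _ H hH)
  · simpa only [star_star, hHF] using key
  · rw [star_add, ethPow_add n d (hstar _ F hF) (hstar _ G hG), star_add]
  · rw [star_smul, ethPow_smul, star_smul, star_star]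
  · rcases lt_or_ge l n with hln | hln
    · rw [ethPow_eq_zero n l hln _ (hstar _ _ (ofFun_sphHarmonic_mem h1 h2)), star_zero]
      exact Submodule.zero_mem _
    · obtain ⟨c, hc0, hc⟩ := exists_spinHarmonic_neg l n m
      rw [← Submodule.smul_mem_iff _ hc0, ← hc]
      exact spinHarmonic_mem_bandLimited (by simpa using hln) (hl.trans h) h1 h2

/-! ### Products -/

theorem isSmoothSpin_of_mem_span {s : ℤ} {S : Set Family} (h : ∀ F ∈ S, IsSmoothSpin s F) :
    ∀ F ∈ Submodule.span ℂ S, IsSmoothSpin s F := by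
  intro F hF
  induction hF using Submodule.span_induction with
  | mem F hF => exact h F hF
  | zero => exact IsSmoothSpin.zero s
  | add a b _ _ ha hb => exact ha.add hb
  | smul c a _ ha => exact ha.smul c

theorem isSmoothSpin_of_mem_mul {r s : ℤ} {M N : Submodule ℂ Family}
    (hM : ∀ F ∈ M, IsSmoothSpin r F) (hN : ∀ F ∈ N, IsSmoothSpin s F) :
    ∀ F ∈ M * N, IsSmoothSpin (r + s) F := by
  intro F hF
  induction hF using Submodule.mul_induction_on' with
  | mem_mul_mem a ha b hb => exact (hM a ha).mul (hN b hb)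
  | add a _ b _ ha hb => exact ha.add hb

theorem isSmoothSpin_of_mem_pow {s : ℤ} {M : Submodule ℂ Family}
    (hM : ∀ F ∈ M, IsSmoothSpin s F) (n : ℕ) : ∀ F ∈ M ^ n, IsSmoothSpin (n * s) F := by
  induction n with
  | zero =>
    intro F hF
    rw [pow_zero, Submodule.mem_one] at hF
    obtain ⟨c, rfl⟩ := hF
    rw [Algebra.algebraMap_eq_smul_one, Nat.cast_zero, zero_mul]
    exact IsSmoothSpin.one.smul c
  | succ n ih =>
    intro F hF
    rw [pow_succ] at hF
    rw [Nat.cast_succ, add_mul, one_mul]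
    exact isSmoothSpin_of_mem_mul ih hM F hF

theorem isSmoothSpin_of_mem_posSpace_mul_nullSpace (d n : ℕ) :
    ∀ F ∈ posSpace ^ d * nullSpace ^ n, IsSmoothSpin n F := by
  have hp : ∀ F ∈ posSpace, IsSmoothSpin 0 F := by
    refine isSmoothSpin_of_mem_span ?_
    rintro _ (rfl | ⟨i, rfl⟩)
    · exact IsSmoothSpin.one
    · exact isSmoothSpin_posFam i
  have hn : ∀ F ∈ nullSpace, IsSmoothSpin 1 F := by
    refine isSmoothSpin_of_mem_span ?_
    rintro _ ⟨i, rfl⟩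
    exact isSmoothSpin_nullFam i
  simpa using isSmoothSpin_of_mem_mul (isSmoothSpin_of_mem_pow hp d) (isSmoothSpin_of_mem_pow hn n)

theorem isSmoothSpin_of_mem_bandLimited {L : ℕ} {s : ℤ} {F : Family}
    (hF : F ∈ bandLimited L s) : IsSmoothSpin s F := by
  obtain ⟨n, rfl | rfl⟩ := s.eq_nat_or_neg
  · exact isSmoothSpin_of_mem_posSpace_mul_nullSpace _ _ F (bandLimited_natCast_le L n hF)
  · have h := (isSmoothSpin_of_mem_posSpace_mul_nullSpace _ _ _
      (star_mem_null _ _ F (bandLimited_neg_le L n hF))).star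
    rwa [star_star] at h

theorem nullSpace_pow_mul_nullStarSpace_pow_le (n : ℕ) :
    nullSpace ^ n * nullStarSpace ^ n ≤ posSpace ^ (2 * n) := by
  rw [← mul_pow, pow_mul]
  exact pow_le_pow_left' nullSpace_mul_nullStarSpace_le n

/-- The smaller of `m` and `n` counts the pairs of a null and a conjugate null factor; each pair
becomes two position factors, and the unpaired factors carry the spin. The position degree plus the
absolute spin is exactly `K + L`. -/
theorem mul_mem_bandLimited_of_opposite {K L m n : ℕ} (hn : n ≤ K) (hm : m ≤ L) {F G : Family}
    (hF : F ∈ bandLimited K n) (hG : G ∈ bandLimited L (-m)) :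
    F * G ∈ bandLimited (K + L + ((n : ℤ) + -m).natAbs) ((n : ℤ) + -m) := by
  have h := Submodule.mul_mem_mul (bandLimited_natCast_le K n hF) (bandLimited_neg_le L m hG)
  rw [mul_mul_mul_comm, ← pow_add] at h
  rcases le_total m n with hmn | hmn
  · obtain ⟨k, rfl⟩ := Nat.exists_eq_add_of_le hmn
    have e : ((m + k : ℕ) : ℤ) + -m = k := by push_cast; ring
    rw [e]
    refine le_bandLimited_natCast (d := K - (m + k) + (L - m) + 2 * m)
      (by rw [Int.natAbs_natCast]; omega) ?_
    rw [pow_add _ _ (2 * m), mul_assoc]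
    refine SetLike.le_def.1 (mul_le_mul_right ?_ _) h
    rw [pow_add, mul_right_comm]
    exact mul_le_mul_left (nullSpace_pow_mul_nullStarSpace_pow_le m) _
  · obtain ⟨k, rfl⟩ := Nat.exists_eq_add_of_le hmn
    have e : (n : ℤ) + -((n + k : ℕ) : ℤ) = -k := by push_cast; ring
    rw [e]
    refine le_bandLimited_neg (d := K - n + (L - (n + k)) + 2 * n)
      (by rw [Int.natAbs_neg, Int.natAbs_natCast]; omega) ?_
    rw [pow_add _ _ (2 * n), mul_assoc]
    refine SetLike.le_def.1 (mul_le_mul_right ?_ _) h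
    rw [pow_add nullStarSpace, ← mul_assoc]
    exact mul_le_mul_left (nullSpace_pow_mul_nullStarSpace_pow_le n) _

theorem mul_mem_bandLimited {K L : ℕ} {r s : ℤ} (hK : r.natAbs ≤ K) (hL : s.natAbs ≤ L)
    {F G : Family} (hF : F ∈ bandLimited K r) (hG : G ∈ bandLimited L s) :
    F * G ∈ bandLimited (K + L + (r + s).natAbs) (r + s) := by
  obtain ⟨n, rfl | rfl⟩ := r.eq_nat_or_neg <;> obtain ⟨m, rfl | rfl⟩ := s.eq_nat_or_neg <;>
    simp only [Int.natAbs_neg, Int.natAbs_natCast] at hK hL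
  · have h := Submodule.mul_mem_mul (bandLimited_natCast_le K n hF)
      (bandLimited_natCast_le L m hG)
    -- Equal signs: the position degree is `(K - n) + (L - m)` and there are `n + m` null factors,
    -- in total `K + L`.
    rw [mul_mul_mul_comm, ← pow_add, ← pow_add] at h
    rw [← Nat.cast_add]
    exact le_bandLimited_natCast (by omega) h
  · exact mul_mem_bandLimited_of_opposite hK hL hF hG
  · rw [mul_comm, add_comm K, add_comm (-(n : ℤ))]
    exact mul_mem_bandLimited_of_opposite hL hK hG hF
  · have h := Submodule.mul_mem_mul (bandLimited_neg_le K n hF) (bandLimited_neg_le L m hG)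
    rw [mul_mul_mul_comm, ← pow_add, ← pow_add] at h
    rw [← neg_add, ← Nat.cast_add]
    exact le_bandLimited_neg (by omega) h

end SpinSphere

end

theorem lemma2p3 (r s : ℤ) (K L : ℕ) (hK : r.natAbs ≤ K) (hL : s.natAbs ≤ L)
    (F G : SpinSphere.Family)
    (hF : F ∈ SpinSphere.bandLimited K r) (hG : G ∈ SpinSphere.bandLimited L s) :
    SpinSphere.IsSmoothSpin (r + s) (F * G) ∧
      F * G ∈ SpinSphere.bandLimited (K + L + (r + s).natAbs) (r + s) :=
  ⟨(SpinSphere.isSmoothSpin_of_mem_bandLimited hF).mul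
    (SpinSphere.isSmoothSpin_of_mem_bandLimited hG),
    SpinSphere.mul_mem_bandLimited hK hL hF hG⟩
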